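/- **Theorem 2.1 (Embeddings).** Let $d\ge 1$, $\langle k\rangle=(1+|k|^2)^{1/2}$, and let $\varphi:\mathbb R^d\to[0,1]$ be a smooth radial bump function with $\varphi(\xi)=0$ for $|\xi|\ge 2$ and $\varphi(\xi)=1$ for $|\xi|<1$. Put $\varphi_0=\varphi$, $\varphi_j(\xi)=\varphi(2^{-j}\xi)-\varphi(2^{-j+1}\xi)$ for $j\ge1$, and $\Delta_j=\mathcal F^{-1}\varphi_j\mathcal F$. For $0\le\alpha<1$ and $k\in\mathbb Z^d$ put $$\varphi_k^\alpha(\xi)=\varphi\Big(\frac{\xi-\langle k\rangle^{\alpha/(1-\alpha)}k}{C\langle k\rangle^{\alpha/(1-\alpha)}}\Big),\qquad \eta_k^\alpha=\varphi_k^\alpha\Big(\sum_{l\in\mathbb Z^d}\varphi_l^\alpha\Big)^{-1},\qquad \square_k^\alpha=\mathcal F^{-1}\eta_k^\alpha\mathcal F ,$$ where $C=C_\alpha>0$ is any constant for which $\sum_l\varphi_l^\alpha$ has no zero (for instance any sufficiently large one), and $\mathcal F$ is the Fourier transform in the space variable $x\in\mathbb R^d$. Let $\mathcal Z$ be the set of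 finite partitions $-\infty=t_0<t_1<\dots<t_K=\infty$. A $U^2$-atom is a step function $a=\sum_{k=1}^K\chi_{[t_{k-1},t_k)}\phi_{k-1}:\mathbb R\to L^2(\mathbb R^d)$ with $\{t_k\}\in\mathcal Z$, $\phi_0=0$, $\sum_k\|\phi_k\|_2^2=1$; $\|u\|_{U^2}$ is the infimum of $\sum_j|c_j|$ over all representations $u=\sum_{j}c_ja_j$ with $c_j\in\mathbb C$ and atoms $a_j$ ($\infty$ if there is none with $\sum_j|c_j|<\infty$). For $v:\mathbb R\to L^2(\mathbb R^d)$ having limits at $\pm\infty$ put $$\|v\|_{V^2}=\sup_{\{t_k\}\in\mathcal Z}\Big(\sum_{k=1}^K\|v(t_k)-v(t_{k-1})\|_2^2\Big)^{1/2},\qquad v(-\infty)=\lim_{t\to-\infty}v(t),\quad v(\infty)=0,$$ and $\|v\|_{V^2}=\infty$ for all other $v$. The $U^2$ or $V^2$ norm of a tempered distribution on $\mathbb R\times\mathbb R^d$ is the infimum of the norms of the functions $\mathbb R\to L^2(\mathbb R^d)$ that represent it ($\infty$ if there is none). For $s\in\mathbb R$ and $0\le\alpha<1$ let $X^{s,\alpha},Y^{s,\alpha},X^{s,1},Y^{s,1}$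 be the spaces of all $u\in\mathcal S'(\mathbb R^{d+1})$ for which, respectively, the following norm is finite: $$\|u\|_{X^{s,\alpha}}=\sum_{k\in\mathbb Z^d}\langle k\rangle^{\frac s{1-\alpha}}\|\square_k^\alpha u\|_{U^2},\qquad \|u\|_{Y^{s,\alpha}}=\sup_{k\in\mathbb Z^d}\langle k\rangle^{\frac s{1-\alpha}}\|\square_k^\alpha u\|_{V^2},$$ $$\|u\|_{X^{s,1}}=\sum_{j\ge0}2^{js}\|\Delta_ju\|_{U^2},\qquad \|u\|_{Y^{s,1}}=\sup_{j\ge0}2^{js}\|\Delta_ju\|_{V^2}.$$ Let $s_1,s_2\in\mathbb R$. The following continuous embeddings hold, that is, the inclusion holds together with a bound of the second norm by a constant times the first. 1. If $0\le\alpha_1,\alpha_2<1$ and $s_1\ge s_2+\max(0,d(\alpha_1-\alpha_2)/2)$, then $X^{s_1,\alpha_1}\subset X^{s_2,\alpha_2}$. 2. If $0\le\alpha<1$ and $s_1\ge s_2+d(1-\alpha)/2$, then $X^{s_1,1}\subset X^{s_2,\alpha}$. 3. If $0\le\alpha_1,\alpha_2<1$ and $s_1\ge s_2+\max(0,d(\alpha_2-\alpha_1)/2)$,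 then $Y^{s_1,\alpha_1}\subset Y^{s_2,\alpha_2}$. 4. If $0\le\alpha<1$ and $s_1\ge s_2+d(1-\alpha)/2$, then $Y^{s_1,\alpha}\subset Y^{s_2,1}$. -/

import Mathlib

open MeasureTheory Filter Topology
open scoped ENNReal NNReal ContDiff SchwartzMap

noncomputable section

namespace AlphaMod

/-- The space `ℝ^d` with its Euclidean norm. -/
abbrev Space (d : ℕ) : Type := EuclideanSpace ℝ (Fin d)

/-- Space-time `ℝ × ℝ^d`, with its Euclidean structure. -/
abbrev SpaceTime (d : ℕ) : Type := WithLp 2 (ℝ × Space d)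

/-- The Hilbert space `L²(ℝ^d)` of complex valued functions. -/
abbrev L2 (d : ℕ) : Type := Lp ℂ 2 (volume : Measure (Space d))

/-! ### Frequency decompositions -/

/-- A smooth radial bump function `φ` with values in `[0,1]`, vanishing outside the ball `B(0,2)`
and equal to `1` on the unit ball. -/
structure IsRadialBump {d : ℕ} (φ : Space d → ℝ) : Prop where
  smooth : ContDiff ℝ ∞ φ
  radial : ∀ ξ η : Space d, ‖ξ‖ = ‖η‖ → φ ξ = φ η
  nonneg : ∀ ξ, 0 ≤ φ ξ
  le_one : ∀ ξ, φ ξ ≤ 1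
  eq_one : ∀ ξ : Space d, ‖ξ‖ < 1 → φ ξ = 1
  eq_zero : ∀ ξ : Space d, 2 ≤ ‖ξ‖ → φ ξ = 0

/-- A lattice point `k ∈ ℤ^d` as a vector of `ℝ^d`. -/
def latticePt {d : ℕ} (k : Fin d → ℤ) : Space d := WithLp.toLp 2 (fun i => (k i : ℝ))

/-- The bracket `⟨k⟩ = (1 + |k|²)^{1/2}`. -/
def bracket {d : ℕ} (k : Fin d → ℤ) : ℝ := Real.sqrt (1 + ‖latticePt k‖ ^ 2)

/-- The dyadic cut-offs: `φ_0 = φ` and `φ_j(ξ) = φ(2^{-j} ξ) - φ(2^{-j+1} ξ)` for `j ≥ 1`. -/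
def dyadicCutoff {d : ℕ} (φ : Space d → ℝ) : ℕ → Space d → ℝ
  | 0, ξ => φ ξ
  | j + 1, ξ => φ (((2 : ℝ) ^ (j + 1))⁻¹ • ξ) - φ (((2 : ℝ) ^ j)⁻¹ • ξ)

/-- `φ_k^α(ξ) = φ((ξ - ⟨k⟩^{α/(1-α)} k) / (C ⟨k⟩^{α/(1-α)}))`. -/
def alphaBump {d : ℕ} (φ : Space d → ℝ) (C α : ℝ) (k : Fin d → ℤ) (ξ : Space d) : ℝ :=
  φ ((C * bracket k ^ (α / (1 - α)))⁻¹ • (ξ - bracket k ^ (α / (1 - α)) • latticePt k))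

/-- `∑_{l ∈ ℤ^d} φ_l^α(ξ)`; for `C > 0` this sum has only finitely many nonzero terms. -/
def alphaBumpSum {d : ℕ} (φ : Space d → ℝ) (C α : ℝ) (ξ : Space d) : ℝ :=
  ∑' l : Fin d → ℤ, alphaBump φ C α l ξ

/-- `η_k^α = φ_k^α / ∑_l φ_l^α`. -/
def alphaCutoff {d : ℕ} (φ : Space d → ℝ) (C α : ℝ) (k : Fin d → ℤ) (ξ : Space d) : ℝ :=
  alphaBump φ C α k ξ * (alphaBumpSum φ C α ξ)⁻¹

/-- The constant `C > 0` is admissible if the denominator in `η_k^α` has no zero, that is, if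
`(η_k^α)_k` is a partition of unity of `ℝ^d`. Every sufficiently large `C` is admissible. -/
def IsAdmissible {d : ℕ} (φ : Space d → ℝ) (C α : ℝ) : Prop :=
  0 < C ∧ ∀ ξ, alphaBumpSum φ C α ξ ≠ 0

/-- `𝓕⁻¹ m 𝓕` acting in the space variable on `𝓢'(ℝ × ℝ^d)`, where `𝓕` is the Fourier transform
with kernel `e^{-i x·ξ}`. Mathlib's transform has the kernel `e^{-2πi x·ξ}`, hence the dilation. -/
def spatialMultiplier {d : ℕ} (m : Space d → ℝ) (u : 𝓢'(SpaceTime d, ℂ)) : 𝓢'(SpaceTime d, ℂ) :=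
  TemperedDistribution.fourierMultiplierCLM ℂ
    (fun z : SpaceTime d => ((m ((2 * Real.pi) • z.snd) : ℝ) : ℂ)) u

/-- The `α`-decomposition operator `□_k^α`. -/
def box {d : ℕ} (φ : Space d → ℝ) (C α : ℝ) (k : Fin d → ℤ) :
    𝓢'(SpaceTime d, ℂ) → 𝓢'(SpaceTime d, ℂ) :=
  spatialMultiplier (alphaCutoff φ C α k)

/-- The dyadic decomposition operator `Δ_j`. -/
def dyadic {d : ℕ} (φ : Space d → ℝ) (j : ℕ) : 𝓢'(SpaceTime d, ℂ) → 𝓢'(SpaceTime d, ℂ) :=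
  spatialMultiplier (dyadicCutoff φ j)

/-! ### The spaces `U²` and `V²` of functions `ℝ → L²(ℝ^d)` -/

/-- A finite partition `-∞ = t_0 < t_1 < ⋯ < t_{K-1} < t_K = ∞`. -/
structure TimePartition where
  K : ℕ
  t : Fin (K + 1) → EReal
  strictMono : StrictMono t
  first : t 0 = ⊥
  last : t (Fin.last K) = ⊤

/-- `U²`-atoms: `a = ∑_{k=1}^K χ_{[t_{k-1}, t_k)} φ_{k-1}` with `∑ ‖φ_k‖² = 1`, `φ_0 = 0`. -/
def IsU2Atom {d : ℕ} (a : ℝ → L2 d) : Prop :=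
  ∃ (P : TimePartition) (f : Fin P.K → L2 d),
    (∀ k : Fin P.K, (k : ℕ) = 0 → f k = 0) ∧
    (∑ k, ‖f k‖ ^ 2 = 1) ∧
    ∀ τ : ℝ, a τ =
      ∑ k : Fin P.K, Set.indicator {τ : ℝ | P.t k.castSucc ≤ τ ∧ (τ : EReal) < P.t k.succ}
        (fun _ => f k) τ

/-- The `U²` norm of `w : ℝ → L²`: the infimum of `∑ |c_j|` over all representations
`w = ∑ c_j a_j` with atoms `a_j`; it is finite exactly when `w ∈ U²`. -/
def u2NormFun {d : ℕ} (w : ℝ → L2 d) : ℝ≥0∞ :=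
  ⨅ (c : ℕ → ℂ) (a : ℕ → ℝ → L2 d) (_ : ∀ j, IsU2Atom (a j))
    (_ : ∀ τ, HasSum (fun j => c j • a j τ) (w τ)), ∑' j, ‖c j‖ₑ

/-- Extension of `v` to `[-∞,∞]` by `v(-∞) = lim_{t → -∞} v(t)` and `v(∞) = 0`. -/
def extendTime {d : ℕ} (v : ℝ → L2 d) (τ : EReal) : L2 d :=
  if τ = ⊤ then 0 else if τ = ⊥ then limUnder atBot v else v τ.toReal

open Classical in
/-- The `V²` norm of `v : ℝ → L²`; it is finite exactly when `v ∈ V²`. -/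
def v2NormFun {d : ℕ} (v : ℝ → L2 d) : ℝ≥0∞ :=
  if (∃ ℓ, Tendsto v atBot (𝓝 ℓ)) ∧ (∃ ℓ, Tendsto v atTop (𝓝 ℓ)) then
    ⨆ P : TimePartition,
      (∑ k : Fin P.K,
        ‖extendTime v (P.t k.succ) - extendTime v (P.t k.castSucc)‖ₑ ^ 2) ^ (1 / 2 : ℝ)
  else ⊤

/-- The tempered distribution `u` on `ℝ × ℝ^d` is given by the function `w : ℝ → L²(ℝ^d)`. -/
def Represents {d : ℕ} (w : ℝ → L2 d) (u : 𝓢'(SpaceTime d, ℂ)) : Prop :=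
  ∀ ψ : 𝓢(SpaceTime d, ℂ), u ψ = ∫ τ : ℝ, ∫ x : Space d, w τ x * ψ (WithLp.toLp 2 (τ, x))

/-- The `U²` norm of a tempered distribution, `∞` if it is not given by a function in `U²`. -/
def u2Norm {d : ℕ} (u : 𝓢'(SpaceTime d, ℂ)) : ℝ≥0∞ :=
  ⨅ (w : ℝ → L2 d) (_ : Represents w u), u2NormFun w

/-- The `V²` norm of a tempered distribution, `∞` if it is not given by a function in `V²`.
Functions in `V²` that give the same distribution differ at most at countably many times; the
infimum is attained at the right continuous one. -/
def v2Norm {d : ℕ} (u : 𝓢'(SpaceTime d, ℂ)) : ℝ≥0∞ :=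
  ⨅ (w : ℝ → L2 d) (_ : Represents w u), v2NormFun w

/-! ### The working spaces -/

/-- `‖u‖_{X^{s,α}} = ∑_k ⟨k⟩^{s/(1-α)} ‖□_k^α u‖_{U²}`, for `0 ≤ α < 1`. -/
def xNorm {d : ℕ} (φ : Space d → ℝ) (C s α : ℝ) (u : 𝓢'(SpaceTime d, ℂ)) : ℝ≥0∞ :=
  ∑' k : Fin d → ℤ, ENNReal.ofReal (bracket k ^ (s / (1 - α))) * u2Norm (box φ C α k u)

/-- `‖v‖_{Y^{s,α}} = sup_k ⟨k⟩^{s/(1-α)} ‖□_k^α v‖_{V²}`, for `0 ≤ α < 1`. -/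
def yNorm {d : ℕ} (φ : Space d → ℝ) (C s α : ℝ) (v : 𝓢'(SpaceTime d, ℂ)) : ℝ≥0∞ :=
  ⨆ k : Fin d → ℤ, ENNReal.ofReal (bracket k ^ (s / (1 - α))) * v2Norm (box φ C α k v)

/-- `‖u‖_{X^{s,1}} = ∑_{j ≥ 0} 2^{js} ‖Δ_j u‖_{U²}`. -/
def xOneNorm {d : ℕ} (φ : Space d → ℝ) (s : ℝ) (u : 𝓢'(SpaceTime d, ℂ)) : ℝ≥0∞ :=
  ∑' j : ℕ, ENNReal.ofReal ((2 : ℝ) ^ ((j : ℝ) * s)) * u2Norm (dyadic φ j u)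

/-- `‖v‖_{Y^{s,1}} = sup_{j ≥ 0} 2^{js} ‖Δ_j v‖_{V²}`. -/
def yOneNorm {d : ℕ} (φ : Space d → ℝ) (s : ℝ) (v : 𝓢'(SpaceTime d, ℂ)) : ℝ≥0∞ :=
  ⨆ j : ℕ, ENNReal.ofReal ((2 : ℝ) ^ ((j : ℝ) * s)) * v2Norm (dyadic φ j v)

/-- The set of tempered distributions for which the norm `N` is finite. -/
def finiteSpace {d : ℕ} (N : 𝓢'(SpaceTime d, ℂ) → ℝ≥0∞) : Set (𝓢'(SpaceTime d, ℂ)) :=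
  {u | N u < ⊤}

/-- Continuous embedding of `{N₁ < ∞}` into `{N₂ < ∞}`: inclusion, with a norm inequality. -/
def Embeds {d : ℕ} (N₁ N₂ : 𝓢'(SpaceTime d, ℂ) → ℝ≥0∞) : Prop :=
  finiteSpace N₁ ⊆ finiteSpace N₂ ∧
    ∃ A : ℝ≥0, ∀ u ∈ finiteSpace N₁, N₂ u ≤ A * N₁ u

end AlphaMod

end

/-!
Each operator in the statement is a Fourier multiplier in the space variable, and both kinds of
families `(η_k^α)_k` and `(φ_j)_j` are smooth partitions of unity of the frequency space with values
in `[0, 1]`. The multipliers therefore act on `U²` and `V²` through the Hilbert space `L²(ℝ^d)`, and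
only Plancherel's theorem is used about them.

Let `(a_i)` be the source partition and `(b_k)` the target partition, and write the multiplier of
`b_k` as the sum of its products with those of the `a_i` that meet `b_k`.

* For the `ℓ¹(U²)` spaces, let `N` of the `b_k` meet `a_i`. The images of an atom under the
  multipliers of these `b_k` are multiples of atoms whose factors are square summable with sum at
  most `1`, because `∑ b_k² ≤ 1`. So by Cauchy–Schwarz the passage from `a_i` to these `b_k` costs
  `N^{1/2}` (`sum_u2NormFun_le`, `tsum_u2Norm_le`).
* For the `ℓ^∞(V²)` spaces, let `N` of the `a_i` meet `b_k`. The multiplier of `b_k` is the sum of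
  those of `b_k a_i / ∑ a_l²` applied after that of `a_i`, and the square sum of these symbols is
  bounded since the `a_l` have bounded overlap. Hence the square variation of the sum is bounded
  by the sum of the square variations, and the cost is again `N^{1/2}`
  (`v2NormFun_sum_le`, `iSup_v2Norm_le`).

It remains to count. The piece `η_k^α` lives at frequencies of size `R = ⟨k⟩^{1/(1-α)}` in a ball of
radius `O(R^α)`, and the centres `⟨k⟩^{α/(1-α)} k` at frequencies of size `R` are separated by
`R^α` (`centre_separated`); the dyadic pieces behave like the case `α = 1` with centre `0`. So a
piece of exponent `γ` and size `R` meets `O(R^{d max(0, γ-α)})` pieces of exponent `α`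
(`sqrt_card_meets_le`), and the square root of this number is the loss of derivatives in the
theorem.

To pass from distributions to the functions that represent them, a multiplier in space has to act
on test functions slice by slice (`fourier_slice`, by Fourier inversion in time), and functions with
finite `U²` or `V²` norm have to be bounded and strongly measurable in time, so that the
representing integrals are additive (`represents_sum`).
-/

noncomputable section

namespace AlphaMod

open FourierTransform

/-! ### Fourier multipliers on `L²(ℝ^d)` and on space-time distributions -/

variable {d : ℕ}

/-- The multipliers that occur in the frequency decompositions: smooth and compactly supported. -/
structure IsSymbol (m : Space d → ℝ) : Prop where
  smooth : ContDiff ℝ ∞ m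
  compact : HasCompactSupport m

/-- The symbol `m` in the frequency variable of Mathlib's Fourier transform. -/
def dilate (m : Space d → ℝ) (ξ : Space d) : ℂ := ((m ((2 * Real.pi) • ξ) : ℝ) : ℂ)

theorem IsSymbol.dilate_contDiff {m : Space d → ℝ} (hm : IsSymbol m) :
    ContDiff ℝ ∞ (dilate m) := by
  have h := hm.smooth
  unfold dilate
  exact Complex.ofRealCLM.contDiff.comp (h.comp (contDiff_const_smul _))

theorem IsSymbol.dilate_compact {m : Space d → ℝ} (hm : IsSymbol m) :
    HasCompactSupport (dilate m) := by
  have h2 : (2 * Real.pi) ≠ 0 := by positivity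
  have h := hm.compact.comp_homeomorph (Homeomorph.smulOfNeZero (2 * Real.pi) h2)
  exact h.comp_left (g := fun r : ℝ => (r : ℂ)) (by simp)

theorem IsSymbol.dilate_temperate {m : Space d → ℝ} (hm : IsSymbol m) :
    (dilate m).HasTemperateGrowth :=
  hm.dilate_compact.hasTemperateGrowth hm.dilate_contDiff

theorem IsSymbol.dilate_snd_temperate {m : Space d → ℝ} (hm : IsSymbol m) :
    (fun z : SpaceTime d => dilate m z.snd).HasTemperateGrowth :=
  hm.dilate_temperate.comp (WithLp.sndL 2 ℝ ℝ (Space d)).hasTemperateGrowth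

theorem spatialMultiplier_eq (m : Space d → ℝ) (u : 𝓢'(SpaceTime d, ℂ)) :
    spatialMultiplier m u =
      TemperedDistribution.fourierMultiplierCLM ℂ (fun z : SpaceTime d => dilate m z.snd) u := rfl

theorem spatialMultiplier_comp {m n : Space d → ℝ} (hm : IsSymbol m) (hn : IsSymbol n)
    (u : 𝓢'(SpaceTime d, ℂ)) :
    spatialMultiplier m (spatialMultiplier n u) = spatialMultiplier (fun ξ => m ξ * n ξ) u := by
  rw [spatialMultiplier_eq, spatialMultiplier_eq, spatialMultiplier_eq,
    TemperedDistribution.fourierMultiplierCLM_fourierMultiplierCLM_apply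
      hn.dilate_snd_temperate hm.dilate_snd_temperate]
  congr 2
  ext z
  simp [dilate, mul_comm]

theorem spatialMultiplier_sum {ι : Type*} {s : Finset ι} {m : ι → Space d → ℝ}
    (hm : ∀ i ∈ s, IsSymbol (m i)) (u : 𝓢'(SpaceTime d, ℂ)) :
    spatialMultiplier (fun ξ => ∑ i ∈ s, m i ξ) u = ∑ i ∈ s, spatialMultiplier (m i) u := by
  simp_rw [spatialMultiplier_eq]
  have h := TemperedDistribution.fourierMultiplierCLM_sum ℂ (s := s)
    (g := fun i => fun z : SpaceTime d => dilate (m i) z.snd)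
    (fun i hi => (hm i hi).dilate_snd_temperate)
  have h2 : (fun z : SpaceTime d => dilate (fun ξ => ∑ i ∈ s, m i ξ) z.snd) =
      fun z => ∑ i ∈ s, dilate (m i) z.snd := by
    ext z; simp [dilate]
  rw [h2, h]
  simp

theorem antilipschitz_slice (τ : ℝ) :
    AntilipschitzWith 1 (fun x : Space d => (WithLp.toLp 2 (τ, x) : SpaceTime d)) := by
  refine AntilipschitzWith.of_le_mul_dist fun x y => ?_
  rw [dist_eq_norm, dist_eq_norm, ← WithLp.toLp_sub, WithLp.prod_norm_eq_of_L2]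
  simp

theorem temperate_slice (τ : ℝ) :
    (fun x : Space d => (WithLp.toLp 2 (τ, x) : SpaceTime d)).HasTemperateGrowth := by
  have h : (fun x : Space d => (WithLp.toLp 2 (τ, x) : SpaceTime d)) =
      fun x => WithLp.toLp 2 (τ, (0 : Space d)) +
        (((WithLp.prodContinuousLinearEquiv 2 ℝ ℝ (Space d)).symm :
          ℝ × Space d →L[ℝ] SpaceTime d).comp (ContinuousLinearMap.inr ℝ ℝ (Space d))) x := by
    ext x : 1
    simp [← WithLp.toLp_add]
  rw [h]
  fun_prop

/-- The restriction of a Schwartz function on space-time to a time slice. -/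
def slice (τ : ℝ) : 𝓢(SpaceTime d, ℂ) →L[ℂ] 𝓢(Space d, ℂ) :=
  SchwartzMap.compCLMOfAntilipschitz ℂ (temperate_slice τ) (antilipschitz_slice τ)

theorem slice_apply (τ : ℝ) (ψ : 𝓢(SpaceTime d, ℂ)) (x : Space d) :
    slice τ ψ x = ψ (WithLp.toLp 2 (τ, x)) := rfl

theorem integrable_prod_of_schwartz (ψ : 𝓢(SpaceTime d, ℂ)) :
    Integrable (fun p : ℝ × Space d => ψ (WithLp.toLp 2 p)) :=
  (WithLp.volume_preserving_toLp ℝ (Space d)).integrable_comp_of_integrable ψ.integrable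

theorem integral_spaceTime (f : SpaceTime d → ℂ) :
    ∫ z, f z = ∫ p : ℝ × Space d, f (WithLp.toLp 2 p) :=
  ((WithLp.volume_preserving_toLp ℝ (Space d)).integral_comp
    (MeasurableEquiv.toLp 2 (ℝ × Space d)).measurableEmbedding f).symm

/-- Schwartz functions on space-time decay in time and space separately. -/
theorem schwartz_decay (ψ : 𝓢(SpaceTime d, ℂ)) (a b : ℕ) : ∃ C : ℝ, 0 ≤ C ∧ ∀ τ x,
    ‖ψ (WithLp.toLp 2 (τ, x))‖ ≤ C * ((1 + ‖τ‖) ^ a)⁻¹ * ((1 + ‖x‖) ^ b)⁻¹ := by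
  refine ⟨2 ^ (a + b) * (Finset.Iic (a + b, 0)).sup
    (fun m => SchwartzMap.seminorm ℝ m.1 m.2) ψ, by positivity, fun τ x => ?_⟩
  have h := SchwartzMap.one_add_le_sup_seminorm_apply (𝕜 := ℝ) (m := (a + b, 0)) (k := a + b)
    (n := 0) le_rfl le_rfl ψ (WithLp.toLp 2 (τ, x))
  rw [norm_iteratedFDeriv_zero] at h
  have h1 : ‖τ‖ ≤ ‖(WithLp.toLp 2 (τ, x) : SpaceTime d)‖ := by
    rw [WithLp.prod_norm_eq_of_L2]
    exact Real.le_sqrt_of_sq_le (by simp)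
  have h2 : ‖x‖ ≤ ‖(WithLp.toLp 2 (τ, x) : SpaceTime d)‖ := by
    rw [WithLp.prod_norm_eq_of_L2]
    exact Real.le_sqrt_of_sq_le (by simp [sq_nonneg])
  rw [← div_eq_mul_inv, ← div_eq_mul_inv, le_div_iff₀ (by positivity), le_div_iff₀ (by positivity)]
  refine le_trans ?_ h
  rw [mul_comm, pow_add, ← mul_assoc, mul_comm]
  have e1 : (1 + ‖τ‖) ^ a ≤ (1 + ‖(WithLp.toLp 2 (τ, x) : SpaceTime d)‖) ^ a := by gcongr
  have e2 : (1 + ‖x‖) ^ b ≤ (1 + ‖(WithLp.toLp 2 (τ, x) : SpaceTime d)‖) ^ b := by gcongr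
  calc _ = (1 + ‖τ‖) ^ a * (1 + ‖x‖) ^ b * ‖ψ (WithLp.toLp 2 (τ, x))‖ := by ring
    _ ≤ _ := by gcongr

/-- The Fourier transform in time of `𝓕⁻¹ ψ` is the inverse Fourier transform in space of `ψ`:
one-dimensional Fourier inversion in the time variable. -/
theorem integral_time_fourierInv (ψ : 𝓢(SpaceTime d, ℂ)) (τ : ℝ) (ξ : Space d) :
    ∫ σ : ℝ, Real.fourierChar (-(inner ℝ σ τ)) • (𝓕⁻ ψ) (WithLp.toLp 2 (σ, ξ)) =
      (𝓕⁻ (slice τ ψ)) ξ := by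
  set P : ℝ → ℂ := fun t => (𝓕⁻ (slice t ψ)) ξ with hP
  have hPe : ∀ t, P t = ∫ x : Space d, Real.fourierChar (inner ℝ x ξ) •
      ψ (WithLp.toLp 2 (t, x)) := fun t => by
    rw [hP]; simp only [SchwartzMap.fourierInv_coe, Real.fourierInv_eq]; rfl
  have hint : Integrable (fun p : ℝ × Space d =>
      Real.fourierChar (inner ℝ p.2 ξ) • ψ (WithLp.toLp 2 p)) := by
    refine (integrable_prod_of_schwartz ψ).mono ?_ (ae_of_all _ fun p => by simp)
    refine Continuous.aestronglyMeasurable ?_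
    have := ψ.continuous
    fun_prop
  have hPint : Integrable P := by
    have := hint.integral_prod_left
    refine this.congr (ae_of_all _ fun t => (hPe t).symm)
  have hPcont : Continuous P := by
    obtain ⟨C, hC0, hC⟩ := schwartz_decay ψ 0 (d + 1)
    have : P = fun t => _ := funext hPe
    rw [this]
    refine continuous_of_dominated (bound := fun x => C * ((1 + ‖x‖) ^ (d + 1))⁻¹) ?_ ?_ ?_ ?_
    · intro t
      refine Continuous.aestronglyMeasurable ?_
      have := ψ.continuous
      fun_prop
    · intro t
      refine ae_of_all _ fun x => ?_
      simpa using hC t x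
    · refine Integrable.const_mul ?_ C
      have := integrable_one_add_norm (E := Space d) (μ := volume) (r := d + 1) (by simp)
      refine this.congr (ae_of_all _ fun x => ?_)
      show _ = _
      simp only
      rw [Real.rpow_neg (by positivity)]
      norm_cast
    · refine ae_of_all _ fun x => ?_
      have := ψ.continuous
      fun_prop
  have hΦ : ∀ σ, (𝓕⁻ ψ) (WithLp.toLp 2 (σ, ξ)) = (𝓕⁻ P) σ := by
    intro σ
    rw [SchwartzMap.fourierInv_coe, Real.fourierInv_eq, Real.fourierInv_eq, integral_spaceTime]
    have e : ∀ p : ℝ × Space d, Real.fourierChar (inner ℝ (WithLp.toLp 2 p : SpaceTime d)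
        (WithLp.toLp 2 (σ, ξ))) • ψ (WithLp.toLp 2 p) =
        Real.fourierChar (inner ℝ p.1 σ) • Real.fourierChar (inner ℝ p.2 ξ) •
          ψ (WithLp.toLp 2 p) := by
      intro p
      rw [WithLp.prod_inner_apply, smul_smul, ← AddChar.map_add_eq_mul]
    simp_rw [e]
    rw [Measure.volume_eq_prod, integral_prod]
    · refine integral_congr_ae (ae_of_all _ fun t => ?_)
      simp only
      rw [hPe t]
      simp_rw [Circle.smul_def]
      exact integral_smul _ _
    · refine hint.mono ?_ (ae_of_all _ fun p => by simp)
      refine Continuous.aestronglyMeasurable ?_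
      have := ψ.continuous
      fun_prop
  have hinv : Integrable (𝓕⁻ P) := by
    have h1 : Integrable (fun σ => (𝓕⁻ ψ) (WithLp.toLp 2 (σ, ξ))) := by
      obtain ⟨C, hC0, hC⟩ := schwartz_decay (𝓕⁻ ψ) 2 0
      have h2 := integrable_one_add_norm (E := ℝ) (μ := volume) (r := 2) (by simp)
      refine (h2.const_mul C).mono' ?_ (ae_of_all _ fun σ => ?_)
      · refine Continuous.aestronglyMeasurable ?_
        have := (𝓕⁻ ψ).continuous
        fun_prop
      · rw [Real.rpow_neg (by positivity)]
        have := hC σ ξ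
        norm_cast at this ⊢
        simpa using this
    exact h1.congr (ae_of_all _ hΦ)
  have hF : Integrable (𝓕 P) := by
    have := hinv.comp_neg
    refine this.congr (ae_of_all _ fun σ => ?_)
    simp only
    rw [Real.fourierInv_eq_fourier_neg, neg_neg]
  have key := hPcont.fourier_fourierInv_eq hPint hF
  simp_rw [hΦ]
  have := congrFun key τ
  rw [Real.fourier_eq] at this
  exact this

/-- A multiplier in the space variable acts on Schwartz functions slice by slice. -/
theorem fourier_slice {m : Space d → ℝ} (hm : IsSymbol m) (ψ : 𝓢(SpaceTime d, ℂ)) (τ : ℝ) :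
    slice τ (𝓕 (SchwartzMap.smulLeftCLM ℂ (fun z : SpaceTime d => dilate m z.snd) (𝓕⁻ ψ))) =
      𝓕 (SchwartzMap.smulLeftCLM ℂ (dilate m) (𝓕⁻ (slice τ ψ))) := by
  ext x
  rw [slice_apply, SchwartzMap.fourier_coe, SchwartzMap.fourier_coe, Real.fourier_eq,
    Real.fourier_eq, integral_spaceTime, Measure.volume_eq_prod, integral_prod_symm]
  · refine integral_congr_ae (ae_of_all _ fun ξ => ?_)
    simp only
    rw [SchwartzMap.smulLeftCLM_apply_apply hm.dilate_temperate, ← integral_time_fourierInv,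
      smul_eq_mul, Circle.smul_def, smul_eq_mul, ← mul_assoc, ← integral_const_mul]
    refine integral_congr_ae (ae_of_all _ fun σ => ?_)
    simp only
    rw [SchwartzMap.smulLeftCLM_apply_apply hm.dilate_snd_temperate, WithLp.prod_inner_apply,
      neg_add, AddChar.map_add_eq_mul]
    simp only [Circle.smul_def, smul_eq_mul, Circle.coe_mul, WithLp.toLp_snd]
    ring
  · refine (integrable_prod_of_schwartz (SchwartzMap.smulLeftCLM ℂ
      (fun z : SpaceTime d => dilate m z.snd) (𝓕⁻ ψ))).mono ?_ (ae_of_all _ fun p => by simp)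
    refine Continuous.aestronglyMeasurable ?_
    have := (SchwartzMap.smulLeftCLM ℂ
      (fun z : SpaceTime d => dilate m z.snd) (𝓕⁻ ψ)).continuous
    fun_prop

theorem IsSymbol.dilate_memLp {m : Space d → ℝ} (hm : IsSymbol m) :
    MemLp (dilate m) ∞ (volume : Measure (Space d)) :=
  hm.dilate_contDiff.continuous.memLp_top_of_hasCompactSupport hm.dilate_compact volume

/-- Pointwise multiplication by a symbol on `L²`. -/
def IsSymbol.mulL2 {m : Space d → ℝ} (hm : IsSymbol m) : L2 d →L[ℂ] L2 d :=
  LinearMap.mkContinuous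
    { toFun := fun f => (hm.dilate_memLp.toLp _ • f : L2 d)
      map_add' := fun f g => Lp.add_smul _ f g
      map_smul' := fun c f => (Lp.smul_comm c _ f).symm }
    ‖hm.dilate_memLp.toLp _‖ (fun f => Lp.norm_smul_le _ f)

theorem IsSymbol.mulL2_apply {m : Space d → ℝ} (hm : IsSymbol m) (f : L2 d) :
    hm.mulL2 f = (hm.dilate_memLp.toLp _ • f : L2 d) := rfl

theorem IsSymbol.coeFn_mulL2 {m : Space d → ℝ} (hm : IsSymbol m) (f : L2 d) :
    hm.mulL2 f =ᵐ[volume] fun ξ => dilate m ξ * f ξ := by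
  rw [hm.mulL2_apply]
  filter_upwards [Lp.coeFn_lpSMul (r := 2) (hm.dilate_memLp.toLp _) f,
    hm.dilate_memLp.coeFn_toLp] with ξ h1 h2
  rw [h1, Pi.smul_apply', h2, smul_eq_mul]

/-- The Fourier multiplier `𝓕⁻¹ m 𝓕` on `L²(ℝ^d)`. -/
def IsSymbol.multL2 {m : Space d → ℝ} (hm : IsSymbol m) : L2 d →L[ℂ] L2 d :=
  ((Lp.fourierTransformₗᵢ (Space d) ℂ).symm.toContinuousLinearEquiv : L2 d →L[ℂ] L2 d) ∘L
    hm.mulL2 ∘L ((Lp.fourierTransformₗᵢ (Space d) ℂ).toContinuousLinearEquiv : L2 d →L[ℂ] L2 d)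

theorem IsSymbol.multL2_apply {m : Space d → ℝ} (hm : IsSymbol m) (f : L2 d) :
    hm.multL2 f = 𝓕⁻ (hm.mulL2 (𝓕 f)) := rfl

theorem IsSymbol.fourier_multL2 {m : Space d → ℝ} (hm : IsSymbol m) (f : L2 d) :
    𝓕 (hm.multL2 f) = hm.mulL2 (𝓕 f) := by
  rw [hm.multL2_apply, fourier_fourierInv_eq]

/-- The transpose of a Fourier multiplier on `L²`, tested against Schwartz functions. -/
theorem IsSymbol.integral_multL2 {m : Space d → ℝ} (hm : IsSymbol m) (f : L2 d)
    (g : 𝓢(Space d, ℂ)) :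
    ∫ x, hm.multL2 f x * g x =
      ∫ x, f x * (𝓕 (SchwartzMap.smulLeftCLM ℂ (dilate m) (𝓕⁻ g))) x := by
  have h : ∀ (f : L2 d) (g : 𝓢(Space d, ℂ)), ∫ x, f x * g x =
      (Lp.toTemperedDistribution f) g := fun f g => by
    rw [Lp.toTemperedDistribution_apply]
    exact integral_congr_ae (ae_of_all _ fun x => mul_comm _ _)
  rw [h, h, hm.multL2_apply, ← Lp.fourierInv_toTemperedDistribution_eq, hm.mulL2_apply,
    Lp.toTemperedDistribution_smul_eq hm.dilate_temperate, ← Lp.fourier_toTemperedDistribution_eq]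
  rfl

theorem represents_spatialMultiplier {m : Space d → ℝ} (hm : IsSymbol m) {w : ℝ → L2 d}
    {u : 𝓢'(SpaceTime d, ℂ)} (h : Represents w u) :
    Represents (fun τ => hm.multL2 (w τ)) (spatialMultiplier m u) := by
  intro ψ
  rw [spatialMultiplier_eq, TemperedDistribution.fourierMultiplierCLM_apply_apply, h]
  refine integral_congr_ae (ae_of_all _ fun τ => ?_)
  have h1 := hm.integral_multL2 (w τ) (slice τ ψ)
  simp only [← fourier_slice hm, slice_apply] at h1
  exact h1.symm

/-! ### Plancherel estimates -/

theorem norm_sq_eq_integral (f : L2 d) : ‖f‖ ^ 2 = ∫ x, ‖f x‖ ^ 2 := by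
  have h := congrArg RCLike.re (L2.inner_def (𝕜 := ℂ) f f)
  rw [inner_self_eq_norm_sq] at h
  rw [h]
  have : ∀ x, inner ℂ (f x) (f x) = ((‖f x‖ ^ 2 : ℝ) : ℂ) := fun x => by
    rw [inner_self_eq_norm_sq_to_K]; norm_cast
  simp_rw [this]
  rw [integral_complex_ofReal]
  simp

theorem integrable_norm_sq (f : L2 d) : Integrable (fun x => ‖f x‖ ^ 2) :=
  (memLp_two_iff_integrable_sq_norm (Lp.aestronglyMeasurable f)).1 (Lp.memLp f)

theorem IsSymbol.norm_multL2_sq {m : Space d → ℝ} (hm : IsSymbol m) (f : L2 d) :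
    ‖hm.multL2 f‖ ^ 2 = ∫ ξ, (m ((2 * Real.pi) • ξ)) ^ 2 * ‖(𝓕 f : L2 d) ξ‖ ^ 2 := by
  rw [← Lp.norm_fourier_eq, norm_sq_eq_integral, hm.fourier_multL2]
  refine integral_congr_ae ?_
  filter_upwards [hm.coeFn_mulL2 (𝓕 f)] with ξ h
  rw [h, norm_mul, mul_pow, dilate, Complex.norm_real, Real.norm_eq_abs, sq_abs]

theorem IsSymbol.integrable_multL2_sq {m : Space d → ℝ} (hm : IsSymbol m) (f : L2 d) :
    Integrable fun ξ => (m ((2 * Real.pi) • ξ)) ^ 2 * ‖(𝓕 f : L2 d) ξ‖ ^ 2 := by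
  refine (integrable_norm_sq (hm.mulL2 (𝓕 f))).congr ?_
  filter_upwards [hm.coeFn_mulL2 (𝓕 f)] with ξ h
  rw [h, norm_mul, mul_pow, dilate, Complex.norm_real, Real.norm_eq_abs, sq_abs]

/-- Almost orthogonality: the pieces of `f` have total square norm at most `‖f‖²`. -/
theorem sum_norm_multL2_sq_le {ι : Type*} (s : Finset ι) {m : ι → Space d → ℝ}
    (hm : ∀ i, IsSymbol (m i)) (h1 : ∀ ξ, ∑ i ∈ s, m i ξ ^ 2 ≤ 1) (f : L2 d) :
    ∑ i ∈ s, ‖(hm i).multL2 f‖ ^ 2 ≤ ‖f‖ ^ 2 := by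
  simp_rw [IsSymbol.norm_multL2_sq]
  rw [← integral_finsetSum _ fun i _ => (hm i).integrable_multL2_sq f, ← Lp.norm_fourier_eq,
    norm_sq_eq_integral (𝓕 f)]
  refine integral_mono (integrable_finsetSum _ fun i _ => (hm i).integrable_multL2_sq f)
    (integrable_norm_sq _) fun ξ => ?_
  simp only
  rw [← Finset.sum_mul]
  exact mul_le_of_le_one_left (by positivity) (h1 _)

/-- The dual estimate: a sum of pieces is controlled by their square sum. -/
theorem norm_sum_multL2_sq_le {ι : Type*} (s : Finset ι) {m : ι → Space d → ℝ}
    (hm : ∀ i, IsSymbol (m i)) {M : ℝ} (h1 : ∀ ξ, ∑ i ∈ s, m i ξ ^ 2 ≤ M) (f : ι → L2 d) :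
    ‖∑ i ∈ s, (hm i).multL2 (f i)‖ ^ 2 ≤ M * ∑ i ∈ s, ‖f i‖ ^ 2 := by
  have e : 𝓕 (∑ i ∈ s, (hm i).multL2 (f i)) = ∑ i ∈ s, (hm i).mulL2 (𝓕 (f i)) := by
    have := map_sum (Lp.fourierTransformₗᵢ (Space d) ℂ) (fun i => (hm i).multL2 (f i)) s
    refine this.trans (Finset.sum_congr rfl fun i _ => (hm i).fourier_multL2 (f i))
  have hint : Integrable fun ξ => M * ∑ i ∈ s, ‖(𝓕 (f i) : L2 d) ξ‖ ^ 2 :=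
    (integrable_finsetSum _ fun i _ => integrable_norm_sq _).const_mul M
  rw [← Lp.norm_fourier_eq, e, norm_sq_eq_integral]
  have e2 : M * ∑ i ∈ s, ‖f i‖ ^ 2 = ∫ ξ, M * ∑ i ∈ s, ‖(𝓕 (f i) : L2 d) ξ‖ ^ 2 := by
    rw [integral_const_mul, integral_finsetSum _ fun i _ => integrable_norm_sq _]
    congr 1
    refine Finset.sum_congr rfl fun i _ => ?_
    rw [← norm_sq_eq_integral, Lp.norm_fourier_eq]
  rw [e2]
  refine integral_mono_ae (integrable_norm_sq _) hint ?_
  have hae : ∀ᵐ ξ, ∀ i ∈ s, (hm i).mulL2 (𝓕 (f i)) ξ = dilate (m i) ξ * (𝓕 (f i) : L2 d) ξ :=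
    (Filter.eventually_all_finset s).2 fun i _ => (hm i).coeFn_mulL2 _
  filter_upwards [hae, Lp.coeFn_finsetSum s fun i => (hm i).mulL2 (𝓕 (f i))] with ξ h2 h3
  rw [h3, Finset.sum_apply, Finset.sum_congr rfl h2]
  calc ‖∑ i ∈ s, dilate (m i) ξ * (𝓕 (f i) : L2 d) ξ‖ ^ 2
      ≤ (∑ i ∈ s, |m i ((2 * Real.pi) • ξ)| * ‖(𝓕 (f i) : L2 d) ξ‖) ^ 2 := by
        gcongr
        refine (norm_sum_le _ _).trans (Finset.sum_le_sum fun i _ => ?_)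
        rw [norm_mul, dilate, Complex.norm_real, Real.norm_eq_abs]
    _ ≤ (∑ i ∈ s, |m i ((2 * Real.pi) • ξ)| ^ 2) * ∑ i ∈ s, ‖(𝓕 (f i) : L2 d) ξ‖ ^ 2 :=
        Finset.sum_mul_sq_le_sq_mul_sq _ _ _
    _ ≤ _ := by
        simp_rw [sq_abs]
        gcongr
        exact h1 _

/-! ### Integrability in time and superposition of representing functions -/

/-- Functions `ℝ → L²` that are bounded and strongly measurable, so that the time integral in
`Represents` is a genuine one. -/
structure IsTame (w : ℝ → L2 d) : Prop where
  meas : StronglyMeasurable w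
  bounded : ∃ B, ∀ τ, ‖w τ‖ ≤ B

theorem continuous_pairing (g : 𝓢(Space d, ℂ)) : Continuous fun f : L2 d => ∫ x, f x * g x := by
  have h : (fun f : L2 d => ∫ x, f x * g x) = fun f =>
      (ContinuousLinearMap.mul ℂ ℂ).lpPairing volume 2 2 f (g.toLp 2) := by
    ext f
    rw [ContinuousLinearMap.lpPairing_eq_integral]
    refine integral_congr_ae ?_
    filter_upwards [g.coeFn_toLp 2 volume] with x hx
    simp [hx]
  rw [h]
  fun_prop

theorem integrable_mul_schwartz (f : L2 d) (g : 𝓢(Space d, ℂ)) :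
    Integrable fun x => f x * g x :=
  MemLp.integrable_mul (Lp.memLp f) (g.memLp 2)

theorem stronglyMeasurable_pairing {w : ℝ → L2 d} (hw : StronglyMeasurable w)
    (ψ : 𝓢(SpaceTime d, ℂ)) :
    StronglyMeasurable fun τ => ∫ x : Space d, w τ x * ψ (WithLp.toLp 2 (τ, x)) := by
  have : Fact ((2 : ℝ≥0∞) ≠ ⊤) := ⟨by simp⟩
  borelize (L2 d)
  have h := stronglyMeasurable_uncurry_of_continuous_of_stronglyMeasurable
    (u := fun (f : L2 d) (τ : ℝ) => ∫ x : Space d, f x * ψ (WithLp.toLp 2 (τ, x)))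
    (fun τ => continuous_pairing (slice τ ψ)) (fun f => by
      refine StronglyMeasurable.integral_prod_right ?_
      refine StronglyMeasurable.mul ?_ ?_
      · exact (Lp.stronglyMeasurable f).comp_measurable measurable_snd
      · refine Continuous.stronglyMeasurable ?_
        have := ψ.continuous
        fun_prop)
  exact h.comp_measurable (hw.measurable.prodMk measurable_id)

theorem IsTame.integrable_pairing {w : ℝ → L2 d} (hw : IsTame w) (ψ : 𝓢(SpaceTime d, ℂ)) :
    Integrable fun τ => ∫ x : Space d, w τ x * ψ (WithLp.toLp 2 (τ, x)) := by
  obtain ⟨B, hB⟩ := hw.bounded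
  obtain ⟨C, hC0, hC⟩ := schwartz_decay ψ 2 (d + 1)
  have hh : Integrable fun x : Space d => ((1 + ‖x‖) ^ (d + 1))⁻¹ := by
    have := integrable_one_add_norm (E := Space d) (μ := volume) (r := d + 1) (by simp)
    refine this.congr (ae_of_all _ fun x => ?_)
    simp only
    rw [Real.rpow_neg (by positivity)]
    norm_cast
  have ht : Integrable fun τ : ℝ => ((1 + ‖τ‖) ^ 2)⁻¹ := by
    have := integrable_one_add_norm (E := ℝ) (μ := volume) (r := 2) (by simp)
    refine this.congr (ae_of_all _ fun x => ?_)
    simp only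
    rw [Real.rpow_neg (by positivity)]
    norm_cast
  set H : ℝ := ∫ x : Space d, ((1 + ‖x‖) ^ (d + 1))⁻¹
  refine (ht.const_mul (C * (B ^ 2 + H))).mono'
    (stronglyMeasurable_pairing hw.meas ψ).aestronglyMeasurable (ae_of_all _ fun τ => ?_)
  have hb : ∀ x, ‖w τ x * ψ (WithLp.toLp 2 (τ, x))‖ ≤
      C * ((1 + ‖τ‖) ^ 2)⁻¹ * (‖w τ x‖ ^ 2 + ((1 + ‖x‖) ^ (d + 1))⁻¹) := fun x => by
    rw [norm_mul]
    set h := ((1 + ‖x‖) ^ (d + 1))⁻¹ with hh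
    have h0 : 0 ≤ h := by positivity
    have h1 : h ≤ 1 := inv_le_one_of_one_le₀ (one_le_pow₀ (by simp))
    -- Young's inequality and `h ≤ 1` avoid the use of the `L²` norm of the slice of `ψ`.
    have hx : ‖w τ x‖ * h ≤ ‖w τ x‖ ^ 2 + h := by
      nlinarith [sq_nonneg (‖w τ x‖ - h), mul_nonneg h0 (sub_nonneg.2 h1), sq_nonneg ‖w τ x‖]
    calc _ ≤ ‖w τ x‖ * (C * ((1 + ‖τ‖) ^ 2)⁻¹ * h) := by gcongr; exact hC τ x
      _ = C * ((1 + ‖τ‖) ^ 2)⁻¹ * (‖w τ x‖ * h) := by ring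
      _ ≤ _ := by gcongr
  refine (norm_integral_le_of_norm_le (((integrable_norm_sq (w τ)).add hh).const_mul _)
    (ae_of_all _ hb)).trans ?_
  rw [integral_const_mul, integral_add' (integrable_norm_sq (w τ)) hh, ← norm_sq_eq_integral]
  have : ‖w τ‖ ^ 2 ≤ B ^ 2 := by gcongr; exact hB τ
  calc C * ((1 + ‖τ‖) ^ 2)⁻¹ * (‖w τ‖ ^ 2 + H) ≤ C * ((1 + ‖τ‖) ^ 2)⁻¹ * (B ^ 2 + H) := by gcongr
    _ = _ := by ring

theorem represents_sum {ι : Type*} (s : Finset ι) {w : ι → ℝ → L2 d} {u : ι → 𝓢'(SpaceTime d, ℂ)}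
    (hw : ∀ i ∈ s, IsTame (w i)) (h : ∀ i ∈ s, Represents (w i) (u i)) :
    Represents (fun τ => ∑ i ∈ s, w i τ) (∑ i ∈ s, u i) := by
  intro ψ
  have e : (∑ i ∈ s, u i) ψ = ∑ i ∈ s, u i ψ := by simp
  rw [e, Finset.sum_congr rfl fun i hi => h i hi ψ,
    ← integral_finsetSum _ fun i hi => (hw i hi).integrable_pairing ψ]
  refine integral_congr_ae (ae_of_all _ fun τ => ?_)
  refine (integral_finsetSum _ fun i _ =>
    integrable_mul_schwartz (w i τ) (slice τ ψ)).symm.trans ?_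
  refine integral_congr_ae ?_
  filter_upwards [Lp.coeFn_finsetSum s fun i => w i τ] with x hx
  rw [hx, Finset.sum_apply, Finset.sum_mul]
  rfl

theorem IsTame.comp_clm {w : ℝ → L2 d} (hw : IsTame w) (T : L2 d →L[ℂ] L2 d) :
    IsTame fun τ => T (w τ) := by
  obtain ⟨B, hB⟩ := hw.bounded
  exact ⟨T.continuous.comp_stronglyMeasurable hw.meas, ‖T‖ * B, fun τ =>
    (T.le_opNorm _).trans (by gcongr; exact hB τ)⟩

/-! ### The space `U²` -/

theorem TimePartition.interval_unique (P : TimePartition) {τ : ℝ} {k l : Fin P.K}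
    (hk : P.t k.castSucc ≤ τ ∧ (τ : EReal) < P.t k.succ)
    (hl : P.t l.castSucc ≤ τ ∧ (τ : EReal) < P.t l.succ) : k = l := by
  rcases lt_trichotomy k l with h | h | h
  · have : P.t k.succ ≤ P.t l.castSucc := P.strictMono.monotone (by simpa using h)
    exact absurd (hk.2.trans_le (this.trans hl.1)) (lt_irrefl _)
  · exact h
  · have : P.t l.succ ≤ P.t k.castSucc := P.strictMono.monotone (by simpa using h)
    exact absurd (hl.2.trans_le (this.trans hk.1)) (lt_irrefl _)

theorem IsU2Atom.stronglyMeasurable {a : ℝ → L2 d} (ha : IsU2Atom a) : StronglyMeasurable a := by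
  obtain ⟨P, f, -, -, h⟩ := ha
  rw [show a = _ from funext h]
  refine Finset.stronglyMeasurable_fun_sum _ fun k _ => ?_
  refine stronglyMeasurable_const.indicator ?_
  exact (measurableSet_le measurable_const measurable_coe_real_ereal).inter
    (measurableSet_lt measurable_coe_real_ereal measurable_const)

theorem IsU2Atom.norm_le_one {a : ℝ → L2 d} (ha : IsU2Atom a) (τ : ℝ) : ‖a τ‖ ≤ 1 := by
  obtain ⟨P, f, -, hf, h⟩ := ha
  rw [h]
  by_cases hτ : ∃ k : Fin P.K, P.t k.castSucc ≤ τ ∧ (τ : EReal) < P.t k.succ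
  · obtain ⟨k, hk⟩ := hτ
    rw [Finset.sum_eq_single k, Set.indicator_of_mem (by exact hk)]
    · have : ‖f k‖ ^ 2 ≤ 1 := by
        rw [← hf]
        exact Finset.single_le_sum (f := fun k => ‖f k‖ ^ 2) (fun _ _ => by positivity)
          (Finset.mem_univ k)
      exact (sq_le_one_iff₀ (norm_nonneg _)).1 this
    · intro l _ hl
      have h' : τ ∉ {τ : ℝ | P.t l.castSucc ≤ τ ∧ (τ : EReal) < P.t l.succ} :=
        fun h' => hl (P.interval_unique h' hk)
      exact Set.indicator_of_notMem h' _
    · simp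
  · rw [Finset.sum_eq_zero]
    · simp
    · intro k _
      have h' : τ ∉ {τ : ℝ | P.t k.castSucc ≤ τ ∧ (τ : EReal) < P.t k.succ} :=
        fun h' => hτ ⟨k, h'⟩
      exact Set.indicator_of_notMem h' _

theorem u2NormFun_le {w : ℝ → L2 d} (c : ℕ → ℂ) (a : ℕ → ℝ → L2 d) (ha : ∀ j, IsU2Atom (a j))
    (h : ∀ τ, HasSum (fun j => c j • a j τ) (w τ)) : u2NormFun w ≤ ∑' j, ‖c j‖ₑ :=
  iInf_le_of_le c <| iInf_le_of_le a <| iInf_le_of_le ha <| iInf_le _ h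

theorem exists_of_u2NormFun_lt {w : ℝ → L2 d} {x : ℝ≥0∞} (h : u2NormFun w < x) :
    ∃ (c : ℕ → ℂ) (a : ℕ → ℝ → L2 d), (∀ j, IsU2Atom (a j)) ∧
      (∀ τ, HasSum (fun j => c j • a j τ) (w τ)) ∧ ∑' j, ‖c j‖ₑ < x := by
  simp only [u2NormFun, iInf_lt_iff] at h
  obtain ⟨c, a, ha, hs, hx⟩ := h
  exact ⟨c, a, ha, hs, hx⟩

theorem isTame_of_u2NormFun_lt_top {w : ℝ → L2 d} (h : u2NormFun w < ⊤) : IsTame w := by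
  obtain ⟨c, a, ha, hs, hx⟩ := exists_of_u2NormFun_lt h
  have hc : Summable fun j => ‖c j‖ := by
    have := ENNReal.tsum_coe_ne_top_iff_summable.1 hx.ne
    exact NNReal.summable_coe.2 this
  refine ⟨StronglyMeasurable.hasSum (fun j => (ha j).stronglyMeasurable.const_smul (c j)) hs,
    ∑' j, ‖c j‖, fun τ => ?_⟩
  rw [← (hs τ).tsum_eq]
  refine tsum_of_norm_bounded hc.hasSum fun j => ?_
  rw [norm_smul]
  exact mul_le_of_le_one_right (norm_nonneg _) ((ha j).norm_le_one τ)

/-- An atom exists, so that the zero function has a representation by atoms. -/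
theorem exists_isU2Atom : ∃ a : ℝ → L2 d, IsU2Atom a := by
  have hnt : Nontrivial (L2 d) := by
    refine ⟨indicatorConstLp 2 (measurableSet_ball (x := (0 : Space d)) (ε := 1))
      measure_ball_lt_top.ne (1 : ℂ), 0, fun h => ?_⟩
    have h2 := congrArg norm h
    rw [norm_indicatorConstLp (by simp) (by simp), norm_zero] at h2
    have hpos : 0 < (volume : Measure (Space d)).real (Metric.ball 0 1) :=
      ENNReal.toReal_pos (Metric.measure_ball_pos _ _ one_pos).ne' measure_ball_lt_top.ne
    have : 0 < (volume : Measure (Space d)).real (Metric.ball 0 1) ^ (1 / (2 : ℝ≥0∞).toReal) :=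
      Real.rpow_pos_of_pos hpos _
    simp only [norm_one, one_mul] at h2
    exact this.ne' h2
  obtain ⟨e, he⟩ := exists_norm_eq (L2 d) zero_le_one
  let P : TimePartition :=
    { K := 2
      t := ![⊥, 0, ⊤]
      strictMono := by
        refine Fin.strictMono_iff_lt_succ.2 fun i => ?_
        fin_cases i
        · exact EReal.bot_lt_zero
        · exact EReal.zero_lt_top
      first := rfl
      last := rfl }
  refine ⟨_, P, ![0, e], ?_, ?_, fun τ => rfl⟩
  · intro k hk
    have : k = (0 : Fin 2) := Fin.ext hk
    rw [this]; rfl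
  · show ∑ k : Fin 2, ‖(![0, e] : Fin 2 → L2 d) k‖ ^ 2 = 1
    simp [he]

theorem u2NormFun_zero : u2NormFun (fun _ => (0 : L2 d)) = 0 := by
  obtain ⟨a, ha⟩ := exists_isU2Atom (d := d)
  refine le_antisymm ?_ zero_le
  refine (u2NormFun_le (fun _ => 0) (fun _ => a) (fun _ => ha) fun τ => ?_).trans (by simp)
  simp

theorem u2NormFun_add_le (v w : ℝ → L2 d) :
    u2NormFun (fun τ => v τ + w τ) ≤ u2NormFun v + u2NormFun w := by
  have key : ∀ (c : ℕ → ℂ) (a : ℕ → ℝ → L2 d) (c' : ℕ → ℂ) (a' : ℕ → ℝ → L2 d),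
      (∀ j, IsU2Atom (a j)) → (∀ τ, HasSum (fun j => c j • a j τ) (v τ)) →
      (∀ j, IsU2Atom (a' j)) → (∀ τ, HasSum (fun j => c' j • a' j τ) (w τ)) →
      u2NormFun (fun τ => v τ + w τ) ≤ ∑' j, ‖c j‖ₑ + ∑' j, ‖c' j‖ₑ := by
    intro c a c' a' ha hs ha' hs'
    let e : ℕ ≃ ℕ ⊕ ℕ := Equiv.natSumNatEquivNat.symm
    refine (u2NormFun_le (fun j => Sum.elim c c' (e j)) (fun j => Sum.elim a a' (e j)) ?_ ?_).trans
      (le_of_eq ?_)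
    · intro j
      cases h : e j with
      | inl i => simpa [h] using ha i
      | inr i => simpa [h] using ha' i
    · intro τ
      exact (e.hasSum_iff (f := fun x => Sum.elim c c' x • Sum.elim a a' x τ)).2
        (HasSum.sum (hs τ) (hs' τ))
    · rw [e.tsum_eq (fun x => ‖Sum.elim c c' x‖ₑ)]
      exact (HasSum.sum (f := fun x => ‖Sum.elim c c' x‖ₑ)
        ENNReal.summable.hasSum ENNReal.summable.hasSum).tsum_eq
  conv_rhs => simp only [u2NormFun, ENNReal.iInf_add, ENNReal.add_iInf]
  exact le_iInf fun c => le_iInf fun a => le_iInf fun ha => le_iInf fun hs =>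
    le_iInf fun c' => le_iInf fun a' => le_iInf fun ha' => le_iInf fun hs' =>
      key c' a' c a ha' hs' ha hs

theorem represents_add {v w : ℝ → L2 d} {u u' : 𝓢'(SpaceTime d, ℂ)} (hv : IsTame v)
    (hw : IsTame w) (h : Represents v u) (h' : Represents w u') :
    Represents (fun τ => v τ + w τ) (u + u') := by
  have := represents_sum (Finset.univ : Finset Bool) (w := fun b => cond b v w)
    (u := fun b => cond b u u') (by simp [hv, hw]) (by simp [h, h'])
  simpa using this

theorem u2Norm_le {w : ℝ → L2 d} {u : 𝓢'(SpaceTime d, ℂ)} (h : Represents w u) :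
    u2Norm u ≤ u2NormFun w := iInf_le_of_le w (iInf_le _ h)

theorem u2Norm_add_le (u u' : 𝓢'(SpaceTime d, ℂ)) : u2Norm (u + u') ≤ u2Norm u + u2Norm u' := by
  conv_rhs => simp only [u2Norm, ENNReal.iInf_add, ENNReal.add_iInf]
  refine le_iInf fun w => le_iInf fun hw => le_iInf fun v => le_iInf fun hv => ?_
  by_cases h : u2NormFun v < ⊤ ∧ u2NormFun w < ⊤
  · refine (u2Norm_le (represents_add (isTame_of_u2NormFun_lt_top h.1)
      (isTame_of_u2NormFun_lt_top h.2) hv hw)).trans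
      (u2NormFun_add_le v w)
  · rw [not_and_or, not_lt_top_iff, not_lt_top_iff] at h
    rcases h with h | h <;> simp [h]

theorem u2Norm_sum_le {ι : Type*} (s : Finset ι) (u : ι → 𝓢'(SpaceTime d, ℂ)) :
    u2Norm (∑ i ∈ s, u i) ≤ ∑ i ∈ s, u2Norm (u i) := by
  classical
  induction s using Finset.induction_on with
  | empty =>
    have : Represents (fun _ => (0 : L2 d)) 0 := by
      simpa using represents_sum (∅ : Finset Bool) (w := fun _ _ => (0 : L2 d)) (u := fun _ => 0)
    simpa using (u2Norm_le this).trans u2NormFun_zero.le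
  | insert i s hi ih =>
    rw [Finset.sum_insert hi, Finset.sum_insert hi]
    exact (u2Norm_add_le _ _).trans (by gcongr)

/-- The image of an atom under an operator is a multiple of an atom; for almost orthogonal
operators the factors are square summable, hence their sum is at most `|s|^{1/2}`. -/
theorem IsU2Atom.exists_image {ι : Type*} (s : Finset ι) (T : ι → L2 d →L[ℂ] L2 d)
    (hT : ∀ f, ∑ i ∈ s, ‖T i f‖ ^ 2 ≤ ‖f‖ ^ 2) {a : ℝ → L2 d} (ha : IsU2Atom a) :
    ∃ (r : ι → ℝ) (b : ι → ℝ → L2 d), (∀ i, 0 ≤ r i) ∧ ∑ i ∈ s, r i ≤ √(s.card) ∧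
      (∀ i, IsU2Atom (b i)) ∧ ∀ i τ, T i (a τ) = (r i : ℂ) • b i τ := by
  obtain ⟨P, f, hf0, hf1, h⟩ := id ha
  let r : ι → ℝ := fun i => √(∑ k, ‖T i (f k)‖ ^ 2)
  have hr2 : ∀ i, r i ^ 2 = ∑ k, ‖T i (f k)‖ ^ 2 := fun i => Real.sq_sqrt (by positivity)
  have hb : ∀ i, ∃ b : ℝ → L2 d, IsU2Atom b ∧ ∀ τ, T i (a τ) = (r i : ℂ) • b τ := by
    intro i
    have hTa : ∀ τ, T i (a τ) = ∑ k : Fin P.K,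
        Set.indicator {τ : ℝ | P.t k.castSucc ≤ τ ∧ (τ : EReal) < P.t k.succ}
          (fun _ => T i (f k)) τ := fun τ => by
      rw [h, map_sum]
      refine Finset.sum_congr rfl fun k _ => ?_
      simp only [Set.indicator]
      split_ifs <;> simp
    -- If the factor vanishes, any atom serves; otherwise the image is normalized by it.
    by_cases hi : r i = 0
    · refine ⟨a, ha, fun τ => ?_⟩
      have h0 : ∀ k, T i (f k) = 0 := by
        have := hr2 i
        rw [hi, zero_pow two_ne_zero, eq_comm,
          Finset.sum_eq_zero_iff_of_nonneg (fun _ _ => by positivity)] at this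
        intro k
        simpa using this k (Finset.mem_univ k)
      rw [hTa, hi]
      simp [h0]
    · refine ⟨fun τ => ((r i : ℂ))⁻¹ • T i (a τ), ⟨P, fun k => ((r i : ℂ))⁻¹ • T i (f k),
        fun k hk => by simp [hf0 k hk], ?_, fun τ => ?_⟩, fun τ => ?_⟩
      · simp_rw [norm_smul, mul_pow]
        rw [← Finset.mul_sum, ← hr2]
        simp [hi]
      · simp only [hTa, Finset.smul_sum]
        refine Finset.sum_congr rfl fun k _ => ?_
        simp only [Set.indicator]
        split_ifs <;> simp
      · rw [smul_smul, mul_inv_cancel₀ (by exact_mod_cast hi), one_smul]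
  choose b hb1 hb2 using hb
  refine ⟨r, b, fun i => Real.sqrt_nonneg _, ?_, hb1, hb2⟩
  refine Real.le_sqrt_of_sq_le ?_
  calc (∑ i ∈ s, r i) ^ 2 ≤ s.card * ∑ i ∈ s, r i ^ 2 := sq_sum_le_card_mul_sum_sq
    _ = s.card * ∑ k, ∑ i ∈ s, ‖T i (f k)‖ ^ 2 := by
        simp_rw [hr2]; rw [Finset.sum_comm]
    _ ≤ s.card * ∑ k, ‖f k‖ ^ 2 := by gcongr; exact hT _
    _ = s.card := by rw [hf1, mul_one]

theorem sum_u2NormFun_le {ι : Type*} (s : Finset ι) (T : ι → L2 d →L[ℂ] L2 d)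
    (hT : ∀ f, ∑ i ∈ s, ‖T i f‖ ^ 2 ≤ ‖f‖ ^ 2) (w : ℝ → L2 d) :
    ∑ i ∈ s, u2NormFun (fun τ => T i (w τ)) ≤ ENNReal.ofReal √(s.card) * u2NormFun w := by
  rcases s.eq_empty_or_nonempty with rfl | hs
  · simp
  have h0 : ENNReal.ofReal √(s.card) ≠ 0 := by
    have : 0 < s.card := hs.card_pos
    rw [ne_eq, ENNReal.ofReal_eq_zero, not_le]
    positivity
  conv_rhs => simp only [u2NormFun, ENNReal.mul_iInf_of_ne h0 ENNReal.ofReal_ne_top]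
  refine le_iInf fun c => le_iInf fun a => le_iInf fun ha => le_iInf fun hw => ?_
  choose r b hr hrs hb hTb using fun j => (ha j).exists_image s T hT
  calc ∑ i ∈ s, u2NormFun (fun τ => T i (w τ))
      ≤ ∑ i ∈ s, ∑' j, ‖c j * r j i‖ₑ := by
        refine Finset.sum_le_sum fun i _ => u2NormFun_le _ (fun j => b j i) (fun j => hb j i) ?_
        intro τ
        have := (hw τ).mapL (T i)
        refine this.congr_fun fun j => ?_
        rw [map_smul, hTb, smul_smul]
    _ = ∑' j, ∑ i ∈ s, ‖c j * r j i‖ₑ :=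
        (Summable.tsum_finsetSum fun _ _ => ENNReal.summable).symm
    _ ≤ ∑' j, ENNReal.ofReal √(s.card) * ‖c j‖ₑ := by
        refine ENNReal.tsum_le_tsum fun j => ?_
        have e : ∀ i, ‖c j * (r j i : ℂ)‖ₑ = ‖c j‖ₑ * ENNReal.ofReal (r j i) := fun i => by
          rw [enorm_mul]
          congr 1
          rw [← ofReal_norm, Complex.norm_real, Real.norm_of_nonneg (hr j i)]
        simp_rw [e]
        rw [← Finset.mul_sum, ← ENNReal.ofReal_sum_of_nonneg fun i _ => hr j i, mul_comm]
        gcongr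
        exact hrs j
    _ = _ := ENNReal.tsum_mul_left

/-! ### The space `V²` -/

theorem limits_of_v2NormFun_lt_top {v : ℝ → L2 d} (h : v2NormFun v < ⊤) :
    (∃ ℓ, Tendsto v atBot (𝓝 ℓ)) ∧ (∃ ℓ, Tendsto v atTop (𝓝 ℓ)) := by
  by_contra h'
  rw [v2NormFun, if_neg h'] at h
  exact lt_irrefl _ h

theorem sum_enorm_sq_le_v2NormFun_sq {v : ℝ → L2 d} (P : TimePartition) :
    ∑ k : Fin P.K, ‖extendTime v (P.t k.succ) - extendTime v (P.t k.castSucc)‖ₑ ^ 2 ≤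
      v2NormFun v ^ 2 := by
  rw [v2NormFun]
  split_ifs with h
  · have := le_iSup (fun P : TimePartition => (∑ k : Fin P.K,
      ‖extendTime v (P.t k.succ) - extendTime v (P.t k.castSucc)‖ₑ ^ 2) ^ (1 / 2 : ℝ)) P
    refine le_trans (le_of_eq ?_) (pow_le_pow_left₀ zero_le this 2)
    rw [← ENNReal.rpow_natCast, ← ENNReal.rpow_mul]
    norm_num
  · simp

theorem extendTime_coe (v : ℝ → L2 d) (t : ℝ) : extendTime v (t : EReal) = v t := by
  simp [extendTime]

theorem strictMono_snoc {n : ℕ} {s : Fin (n + 1) → EReal} (hs : StrictMono s) {x : EReal}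
    (hx : s (Fin.last n) < x) : StrictMono (Fin.snoc s x : Fin (n + 2) → EReal) := by
  refine Fin.strictMono_iff_lt_succ.2 fun i => ?_
  refine Fin.lastCases ?_ (fun j => ?_) i
  · rw [Fin.snoc_castSucc, Fin.succ_last, Fin.snoc_last]
    exact hx
  · rw [Fin.snoc_castSucc, Fin.succ_castSucc, Fin.snoc_castSucc]
    exact hs Fin.castSucc_lt_succ

theorem sum_snoc {n : ℕ} (s : Fin (n + 1) → EReal) (x : EReal) (g : EReal → EReal → ℝ≥0∞) :
    ∑ k : Fin (n + 1), g ((Fin.snoc s x : Fin (n + 2) → EReal) k.succ)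
      ((Fin.snoc s x : Fin (n + 2) → EReal) k.castSucc) =
    ∑ k : Fin n, g (s k.succ) (s k.castSucc) + g x (s (Fin.last n)) := by
  rw [Fin.sum_univ_castSucc]
  congr 1
  · refine Finset.sum_congr rfl fun k _ => ?_
    rw [Fin.snoc_castSucc, Fin.succ_castSucc, Fin.snoc_castSucc]
  · rw [Fin.snoc_castSucc, Fin.succ_last, Fin.snoc_last]

/-- The square variation of `v` on `[-∞, t]`. -/
def variationUpTo (v : ℝ → L2 d) (t : ℝ) : ℝ≥0∞ :=
  ⨆ (n : ℕ) (s : Fin (n + 1) → EReal) (_ : StrictMono s) (_ : s 0 = ⊥)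
    (_ : s (Fin.last n) = t),
    ∑ k : Fin n, ‖extendTime v (s k.succ) - extendTime v (s k.castSucc)‖ₑ ^ 2

theorem le_variationUpTo {v : ℝ → L2 d} {t : ℝ} {n : ℕ} {s : Fin (n + 1) → EReal}
    (hs : StrictMono s) (h0 : s 0 = ⊥) (h1 : s (Fin.last n) = t) :
    ∑ k : Fin n, ‖extendTime v (s k.succ) - extendTime v (s k.castSucc)‖ₑ ^ 2 ≤
      variationUpTo v t :=
  le_iSup_of_le n <| le_iSup_of_le s <| le_iSup_of_le hs <| le_iSup_of_le h0 <| le_iSup_of_le h1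
    le_rfl

theorem variationUpTo_le {v : ℝ → L2 d} (t : ℝ) : variationUpTo v t ≤ v2NormFun v ^ 2 := by
  refine iSup_le fun n => iSup_le fun s => iSup_le fun hs => iSup_le fun h0 => iSup_le fun h1 => ?_
  let P : TimePartition :=
    { K := n + 1
      t := Fin.snoc s ⊤
      strictMono := strictMono_snoc hs (by rw [h1]; exact EReal.coe_lt_top t)
      first := by
        have : (0 : Fin (n + 2)) = Fin.castSucc 0 := rfl
        rw [this, Fin.snoc_castSucc, h0]
      last := Fin.snoc_last _ _ }
  refine le_trans ?_ (sum_enorm_sq_le_v2NormFun_sq P)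
  have := sum_snoc s ⊤ (fun x y => ‖extendTime v x - extendTime v y‖ₑ ^ 2)
  refine le_trans ?_ this.ge
  exact le_self_add

theorem variationUpTo_add_le {v : ℝ → L2 d} {s t : ℝ} (hst : s < t) :
    variationUpTo v s + ‖v t - v s‖ₑ ^ 2 ≤ variationUpTo v t := by
  have key : ∀ (n : ℕ) (p : Fin (n + 1) → EReal), StrictMono p → p 0 = ⊥ →
      p (Fin.last n) = s →
      ∑ k : Fin n, ‖extendTime v (p k.succ) - extendTime v (p k.castSucc)‖ₑ ^ 2 +
        ‖v t - v s‖ₑ ^ 2 ≤ variationUpTo v t := by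
    intro n p hp h0 h1
    have h2 := sum_snoc p t (fun x y => ‖extendTime v x - extendTime v y‖ₑ ^ 2)
    rw [h1, extendTime_coe, extendTime_coe] at h2
    rw [← h2]
    refine le_variationUpTo (strictMono_snoc hp (by rw [h1]; exact_mod_cast hst)) ?_
      (Fin.snoc_last _ _)
    have : (0 : Fin (n + 2)) = Fin.castSucc 0 := rfl
    rw [this, Fin.snoc_castSucc, h0]
  have hfin : ‖v t - v s‖ₑ ^ 2 ≠ ⊤ := by finiteness
  have hle : ‖v t - v s‖ₑ ^ 2 ≤ variationUpTo v t := by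
    refine le_add_self.trans (key 1 ![⊥, (s : EReal)] ?_ rfl rfl)
    refine Fin.strictMono_iff_lt_succ.2 fun i => ?_
    fin_cases i
    exact EReal.bot_lt_coe s
  have hsub : variationUpTo v s ≤ variationUpTo v t - ‖v t - v s‖ₑ ^ 2 :=
    iSup_le fun n => iSup_le fun p => iSup_le fun hp => iSup_le fun h0 => iSup_le fun h1 =>
      ENNReal.le_sub_of_add_le_right hfin (key n p hp h0 h1)
  calc _ ≤ variationUpTo v t - ‖v t - v s‖ₑ ^ 2 + ‖v t - v s‖ₑ ^ 2 := by gcongr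
    _ = _ := tsub_add_cancel_of_le hle

/-- A function of bounded square variation is continuous off a countable set: its jumps are
controlled by those of the monotone function `variationUpTo`. -/
theorem countable_discontinuities {v : ℝ → L2 d} (h : v2NormFun v < ⊤) :
    {t | ¬ ContinuousAt v t}.Countable := by
  have hfin : ∀ t, variationUpTo v t ≠ ⊤ := fun t =>
    ((variationUpTo_le t).trans_lt (ENNReal.pow_lt_top h)).ne
  let g : ℝ → ℝ := fun t => (variationUpTo v t).toReal
  have hg : ∀ s t, s < t → ‖v t - v s‖ ^ 2 ≤ g t - g s := fun s t hst => by
    have h1 := ENNReal.toReal_mono (hfin t) (variationUpTo_add_le (v := v) hst)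
    rw [ENNReal.toReal_add (hfin s) (by finiteness), ENNReal.toReal_pow, toReal_enorm] at h1
    linarith
  have hmono : Monotone g := fun s t hst => by
    rcases hst.eq_or_lt with rfl | hst
    · exact le_rfl
    · nlinarith [hg s t hst, sq_nonneg ‖v t - v s‖]
  refine hmono.countable_not_continuousAt.mono fun t ht => ?_
  contrapose! ht
  simp only [Set.mem_ofPred_eq, not_not] at ht ⊢
  have h2 : ∀ s, ‖v s - v t‖ ≤ √|g s - g t| := fun s => by
    refine Real.le_sqrt_of_sq_le ?_
    rcases lt_trichotomy s t with hs | rfl | hs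
    · rw [norm_sub_rev, abs_sub_comm]
      exact (hg s t hs).trans (le_abs_self _)
    · simp
    · exact (hg t s hs).trans (le_abs_self _)
  rw [ContinuousAt, tendsto_iff_norm_sub_tendsto_zero]
  refine squeeze_zero (fun _ => norm_nonneg _) h2 ?_
  have h3 : Tendsto (fun s => √|g s - g t|) (𝓝 t) (𝓝 √|g t - g t|) :=
    ((ht.sub continuousAt_const).abs).sqrt
  simpa using h3

/-- The partition `-∞ < t < ∞` bounds `‖v t‖`, because `v(∞) = 0` by convention. -/
theorem isTame_of_v2NormFun_lt_top {v : ℝ → L2 d} (h : v2NormFun v < ⊤) : IsTame v := by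
  refine ⟨StronglyMeasurable.of_countable_not_continuousAt (countable_discontinuities h),
    (v2NormFun v).toReal, fun t => ?_⟩
  let P : TimePartition :=
    { K := 2
      t := ![⊥, (t : EReal), ⊤]
      strictMono := by
        refine Fin.strictMono_iff_lt_succ.2 fun i => ?_
        fin_cases i
        · exact EReal.bot_lt_coe t
        · exact EReal.coe_lt_top t
      first := rfl
      last := rfl }
  have h1 := sum_enorm_sq_le_v2NormFun_sq (v := v) P
  have h2 : ‖v t‖ₑ ^ 2 ≤ v2NormFun v ^ 2 := by
    refine le_trans ?_ h1
    show _ ≤ ∑ k : Fin 2, _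
    rw [Fin.sum_univ_two]
    refine le_trans (le_of_eq ?_) le_add_self
    show _ = ‖extendTime v ⊤ - extendTime v (t : EReal)‖ₑ ^ 2
    rw [extendTime_coe]
    simp [extendTime]
  have h3 : ‖v t‖ₑ ≤ v2NormFun v := (ENNReal.pow_le_pow_left_iff two_ne_zero).1 h2
  have := ENNReal.toReal_mono h.ne h3
  rwa [toReal_enorm] at this

theorem extendTime_sum {ι : Type*} (s : Finset ι) (T : ι → L2 d →L[ℂ] L2 d) {w : ι → ℝ → L2 d}
    (hw : ∀ i ∈ s, v2NormFun (w i) < ⊤) (τ : EReal) :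
    extendTime (fun t => ∑ i ∈ s, T i (w i t)) τ = ∑ i ∈ s, T i (extendTime (w i) τ) := by
  unfold extendTime
  split_ifs with h1 h2
  · simp
  · refine Tendsto.limUnder_eq ?_
    refine tendsto_finsetSum _ fun i hi => ((T i).continuous.tendsto _).comp ?_
    exact tendsto_nhds_limUnder (limits_of_v2NormFun_lt_top (hw i hi)).1
  · rfl

/-- The `V²` norm of a superposition, when the operators satisfy a dual orthogonality bound. -/
theorem v2NormFun_sum_le {ι : Type*} (s : Finset ι) (T : ι → L2 d →L[ℂ] L2 d) {M : ℝ}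
    (hM : 0 ≤ M) (hT : ∀ f : ι → L2 d, ‖∑ i ∈ s, T i (f i)‖ ^ 2 ≤ M * ∑ i ∈ s, ‖f i‖ ^ 2)
    {w : ι → ℝ → L2 d} {B : ℝ≥0∞} (hB : B < ⊤) (hw : ∀ i ∈ s, v2NormFun (w i) ≤ B) :
    v2NormFun (fun t => ∑ i ∈ s, T i (w i t)) ≤ ENNReal.ofReal (√M * √(s.card)) * B := by
  have hw' : ∀ i ∈ s, v2NormFun (w i) < ⊤ := fun i hi => (hw i hi).trans_lt hB
  have hlim : (∃ ℓ, Tendsto (fun t => ∑ i ∈ s, T i (w i t)) atBot (𝓝 ℓ)) ∧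
      (∃ ℓ, Tendsto (fun t => ∑ i ∈ s, T i (w i t)) atTop (𝓝 ℓ)) := by
    have h := fun i hi => limits_of_v2NormFun_lt_top (hw' i hi)
    exact ⟨⟨∑ i ∈ s, T i (limUnder atBot (w i)), tendsto_finsetSum _ fun i hi =>
      ((T i).continuous.tendsto _).comp (tendsto_nhds_limUnder (h i hi).1)⟩,
      ⟨∑ i ∈ s, T i (limUnder atTop (w i)), tendsto_finsetSum _ fun i hi =>
      ((T i).continuous.tendsto _).comp (tendsto_nhds_limUnder (h i hi).2)⟩⟩
  rw [v2NormFun, if_pos hlim]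
  refine iSup_le fun P => ?_
  have hT' : ∀ f : ι → L2 d, ‖∑ i ∈ s, T i (f i)‖ₑ ^ 2 ≤ ENNReal.ofReal M * ∑ i ∈ s, ‖f i‖ₑ ^ 2 :=
    fun f => by
      have := ENNReal.ofReal_le_ofReal (hT f)
      rw [ENNReal.ofReal_mul hM, ENNReal.ofReal_sum_of_nonneg fun _ _ => by positivity] at this
      simpa only [ENNReal.ofReal_pow (norm_nonneg _), ofReal_norm] using this
  have hsq : ∑ k : Fin P.K, ‖extendTime (fun t => ∑ i ∈ s, T i (w i t)) (P.t k.succ) -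
      extendTime (fun t => ∑ i ∈ s, T i (w i t)) (P.t k.castSucc)‖ₑ ^ 2 ≤
      (ENNReal.ofReal (√M * √(s.card)) * B) ^ 2 := by
    calc _ ≤ ∑ k : Fin P.K, ENNReal.ofReal M * ∑ i ∈ s,
          ‖extendTime (w i) (P.t k.succ) - extendTime (w i) (P.t k.castSucc)‖ₑ ^ 2 := by
          refine Finset.sum_le_sum fun k _ => ?_
          rw [extendTime_sum s T hw', extendTime_sum s T hw', ← Finset.sum_sub_distrib]
          simp_rw [← map_sub]
          exact hT' _
      _ = ENNReal.ofReal M * ∑ i ∈ s, ∑ k : Fin P.K,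
          ‖extendTime (w i) (P.t k.succ) - extendTime (w i) (P.t k.castSucc)‖ₑ ^ 2 := by
          rw [← Finset.mul_sum, Finset.sum_comm]
      _ ≤ ENNReal.ofReal M * ∑ i ∈ s, B ^ 2 := by
          gcongr with i hi
          exact (sum_enorm_sq_le_v2NormFun_sq P).trans (pow_le_pow_left₀ zero_le (hw i hi) 2)
      _ = _ := by
          rw [mul_pow, ← ENNReal.ofReal_pow (by positivity), mul_pow, Real.sq_sqrt hM,
            Real.sq_sqrt (by positivity), ENNReal.ofReal_mul hM, ENNReal.ofReal_natCast]
          simp [mul_assoc]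
  calc _ ≤ ((ENNReal.ofReal (√M * √(s.card)) * B) ^ 2) ^ (1 / 2 : ℝ) := by gcongr
    _ = _ := by
      rw [← ENNReal.rpow_natCast, ← ENNReal.rpow_mul]
      norm_num

/-! ### Comparison of two partitions of unity -/

/-- A smooth, locally finite partition of unity of the frequency space `ℝ^d` by nonnegative
functions with compact support. -/
structure IsPartition {ι : Type*} (a : ι → Space d → ℝ) : Prop where
  symbol : ∀ i, IsSymbol (a i)
  nonneg : ∀ i ξ, 0 ≤ a i ξ
  locallyFinite : LocallyFinite fun i => Function.support (a i)
  sum_eq_one : ∀ ξ, ∑ᶠ i, a i ξ = 1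

theorem IsPartition.finite_support {ι : Type*} {a : ι → Space d → ℝ} (ha : IsPartition a)
    (ξ : Space d) : {i | a i ξ ≠ 0}.Finite := ha.locallyFinite.point_finite ξ

theorem IsPartition.finite_meets {ι : Type*} {a : ι → Space d → ℝ} (ha : IsPartition a)
    {b : Space d → ℝ} (hb : IsSymbol b) : {i | ∃ ξ, a i ξ ≠ 0 ∧ b ξ ≠ 0}.Finite := by
  refine (ha.locallyFinite.finite_nonempty_inter_compact hb.compact).subset ?_
  rintro i ⟨ξ, h1, h2⟩
  exact ⟨ξ, h1, subset_tsupport _ h2⟩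

theorem IsPartition.sum_le_one {ι : Type*} {a : ι → Space d → ℝ} (ha : IsPartition a)
    (s : Finset ι) (ξ : Space d) : ∑ i ∈ s, a i ξ ≤ 1 := by
  classical
  rw [← ha.sum_eq_one ξ, finsum_eq_sum_of_support_subset (s := s ∪ (ha.finite_support ξ).toFinset)]
  · exact Finset.sum_le_sum_of_subset_of_nonneg Finset.subset_union_left
      fun i _ _ => ha.nonneg i ξ
  · intro i hi
    simp only [Finset.coe_union, Set.Finite.coe_toFinset]
    exact Or.inr hi

theorem IsPartition.le_one {ι : Type*} {a : ι → Space d → ℝ} (ha : IsPartition a) (i : ι)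
    (ξ : Space d) : a i ξ ≤ 1 := by
  simpa using ha.sum_le_one {i} ξ

theorem IsPartition.sum_eq_one_of_subset {ι : Type*} {a : ι → Space d → ℝ} (ha : IsPartition a)
    {s : Finset ι} {ξ : Space d} (h : ∀ i, a i ξ ≠ 0 → i ∈ s) : ∑ i ∈ s, a i ξ = 1 := by
  rw [← ha.sum_eq_one ξ]
  exact (finsum_eq_sum_of_support_subset _ h).symm

theorem IsPartition.sum_sq_le_one {ι : Type*} {a : ι → Space d → ℝ} (ha : IsPartition a)
    (s : Finset ι) (ξ : Space d) : ∑ i ∈ s, a i ξ ^ 2 ≤ 1 := by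
  refine le_trans (Finset.sum_le_sum fun i _ => ?_) (ha.sum_le_one s ξ)
  have h0 := ha.nonneg i ξ
  have h1 := ha.le_one i ξ
  nlinarith

theorem IsSymbol.mul {m n : Space d → ℝ} (hm : IsSymbol m) (hn : IsSymbol n) :
    IsSymbol fun ξ => m ξ * n ξ :=
  ⟨hm.smooth.mul hn.smooth, hm.compact.mul_right⟩

theorem sum_u2Norm_spatialMultiplier_le {κ : Type*} {b : κ → Space d → ℝ} (hb : IsPartition b)
    (s : Finset κ) (u : 𝓢'(SpaceTime d, ℂ)) :
    ∑ k ∈ s, u2Norm (spatialMultiplier (b k) u) ≤ ENNReal.ofReal √(s.card) * u2Norm u := by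
  rcases s.eq_empty_or_nonempty with rfl | hs
  · simp
  have h0 : ENNReal.ofReal √(s.card) ≠ 0 := by
    have : 0 < s.card := hs.card_pos
    rw [ne_eq, ENNReal.ofReal_eq_zero, not_le]
    positivity
  conv_rhs => simp only [u2Norm, ENNReal.mul_iInf_of_ne h0 ENNReal.ofReal_ne_top]
  refine le_iInf fun w => le_iInf fun hw => ?_
  refine le_trans (Finset.sum_le_sum fun k _ =>
    u2Norm_le (represents_spatialMultiplier (hb.symbol k) hw)) ?_
  exact sum_u2NormFun_le s (fun k => (hb.symbol k).multL2)
    (sum_norm_multL2_sq_le s hb.symbol (hb.sum_sq_le_one s)) w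

/-- A multiplier splits into its products with the members of a partition of unity. -/
theorem IsPartition.spatialMultiplier_eq_sum {ι : Type*} {a : ι → Space d → ℝ}
    (ha : IsPartition a) {b : Space d → ℝ} (hb : IsSymbol b) (u : 𝓢'(SpaceTime d, ℂ)) :
    spatialMultiplier b u =
      ∑ i ∈ (ha.finite_meets hb).toFinset, spatialMultiplier b (spatialMultiplier (a i) u) := by
  simp_rw [fun i => spatialMultiplier_comp hb (ha.symbol i) u]
  rw [← spatialMultiplier_sum fun i _ => hb.mul (ha.symbol i)]
  congr 1
  ext ξ
  rw [← Finset.mul_sum]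
  by_cases h : b ξ = 0
  · simp [h]
  · rw [ha.sum_eq_one_of_subset fun i hi => by simpa using ⟨ξ, hi, h⟩, mul_one]

/-- Comparison of weighted `ℓ¹(U²)` norms: each piece `a i` is spread over the pieces `b k` that
it meets, at the cost of the square root of their number. -/
theorem tsum_u2Norm_le {ι κ : Type*} {a : ι → Space d → ℝ} {b : κ → Space d → ℝ}
    (ha : IsPartition a) (hb : IsPartition b) {W : ι → ℝ} {V : κ → ℝ} {A : ℝ} (hA : 0 ≤ A)
    (h : ∀ i k, (∃ ξ, b k ξ ≠ 0 ∧ a i ξ ≠ 0) →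
      √({k | ∃ ξ, b k ξ ≠ 0 ∧ a i ξ ≠ 0}.ncard) * V k ≤ A * W i)
    (u : 𝓢'(SpaceTime d, ℂ)) :
    ∑' k, ENNReal.ofReal (V k) * u2Norm (spatialMultiplier (b k) u) ≤
      ENNReal.ofReal A * ∑' i, ENNReal.ofReal (W i) * u2Norm (spatialMultiplier (a i) u) := by
  classical
  let S : ι → Finset κ := fun i => (hb.finite_meets (ha.symbol i)).toFinset
  have hS : ∀ i k, k ∈ S i ↔ ∃ ξ, b k ξ ≠ 0 ∧ a i ξ ≠ 0 := fun i k => by simp [S]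
  have hcard : ∀ i, {k | ∃ ξ, b k ξ ≠ 0 ∧ a i ξ ≠ 0}.ncard = (S i).card := fun i =>
    Set.ncard_eq_toFinset_card _ _
  let G : κ → ι → ℝ≥0∞ := fun k i => if k ∈ S i then ENNReal.ofReal (V k) *
    u2Norm (spatialMultiplier (b k) (spatialMultiplier (a i) u)) else 0
  calc _ ≤ ∑' k, ∑' i, G k i := by
        refine ENNReal.tsum_le_tsum fun k => ?_
        rw [ha.spatialMultiplier_eq_sum (hb.symbol k)]
        calc _ ≤ ENNReal.ofReal (V k) * ∑ i ∈ (ha.finite_meets (hb.symbol k)).toFinset,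
              u2Norm (spatialMultiplier (b k) (spatialMultiplier (a i) u)) := by
              gcongr; exact u2Norm_sum_le _ _
          _ = ∑ i ∈ (ha.finite_meets (hb.symbol k)).toFinset, G k i := by
              rw [Finset.mul_sum]
              refine Finset.sum_congr rfl fun i hi => ?_
              have : k ∈ S i := (hS i k).2 (by simpa [and_comm] using hi)
              simp [G, this]
          _ ≤ _ := ENNReal.sum_le_tsum _
    _ = ∑' i, ∑' k, G k i := ENNReal.tsum_comm
    _ = ∑' i, ∑ k ∈ S i, ENNReal.ofReal (V k) *
          u2Norm (spatialMultiplier (b k) (spatialMultiplier (a i) u)) := by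
        refine tsum_congr fun i => ?_
        rw [tsum_eq_sum (s := S i) fun k hk => by simp [G, hk]]
        exact Finset.sum_congr rfl fun k hk => by simp [G, hk]
    _ ≤ ∑' i, ENNReal.ofReal A * (ENNReal.ofReal (W i) * u2Norm (spatialMultiplier (a i) u)) := by
        refine ENNReal.tsum_le_tsum fun i => ?_
        rcases (S i).eq_empty_or_nonempty with hi | hi
        · simp [hi]
        have hN : 0 < √((S i).card : ℝ) := Real.sqrt_pos.2 (by exact_mod_cast hi.card_pos)
        calc _ ≤ ∑ k ∈ S i, ENNReal.ofReal (A * W i / √((S i).card)) *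
              u2Norm (spatialMultiplier (b k) (spatialMultiplier (a i) u)) := by
              refine Finset.sum_le_sum fun k hk => ?_
              gcongr
              rw [le_div_iff₀ hN, mul_comm, ← hcard]
              exact h i k ((hS i k).1 hk)
          _ ≤ ENNReal.ofReal (A * W i / √((S i).card)) * (ENNReal.ofReal √((S i).card) *
              u2Norm (spatialMultiplier (a i) u)) := by
              rw [← Finset.mul_sum]
              gcongr
              exact sum_u2Norm_spatialMultiplier_le hb _ _
          _ = _ := by
              rw [← mul_assoc, ← mul_assoc, ← ENNReal.ofReal_mul' hN.le, ← ENNReal.ofReal_mul hA,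
                div_mul_cancel₀ _ hN.ne']
    _ = _ := ENNReal.tsum_mul_left

theorem v2Norm_le {w : ℝ → L2 d} {u : 𝓢'(SpaceTime d, ℂ)} (h : Represents w u) :
    v2Norm u ≤ v2NormFun w := iInf_le_of_le w (iInf_le _ h)

theorem IsPartition.squareSum_contDiff {ι : Type*} {a : ι → Space d → ℝ} (ha : IsPartition a) :
    ContDiff ℝ ∞ fun ξ => ∑ᶠ i, a i ξ ^ 2 := by
  rw [← contMDiff_iff_contDiff]
  refine contMDiff_finsum (fun i => ?_) ?_
  · exact contMDiff_iff_contDiff.2 ((ha.symbol i).smooth.pow 2)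
  · refine ha.locallyFinite.subset fun i ξ hξ => ?_
    simpa using hξ

/-- The square sum of a partition of unity with overlap at most `M` is at least `1 / M`. -/
theorem IsPartition.one_le_mul_squareSum {ι : Type*} {a : ι → Space d → ℝ} (ha : IsPartition a)
    {M : ℕ} {ξ : Space d} (hM : {i | a i ξ ≠ 0}.ncard ≤ M) : 1 ≤ M * ∑ᶠ i, a i ξ ^ 2 := by
  have hfin := ha.finite_support ξ
  have h1 : ∑ i ∈ hfin.toFinset, a i ξ = 1 := ha.sum_eq_one_of_subset fun i hi => by simpa using hi
  have h2 : ∑ᶠ i, a i ξ ^ 2 = ∑ i ∈ hfin.toFinset, a i ξ ^ 2 :=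
    finsum_eq_sum_of_support_subset _ fun i hi => by simpa using hi
  have h3 : hfin.toFinset.card ≤ M := by rwa [← Set.ncard_eq_toFinset_card _ hfin]
  calc (1 : ℝ) = (∑ i ∈ hfin.toFinset, a i ξ) ^ 2 := by rw [h1, one_pow]
    _ ≤ hfin.toFinset.card * ∑ i ∈ hfin.toFinset, a i ξ ^ 2 := sq_sum_le_card_mul_sum_sq
    _ ≤ _ := by
      rw [h2]
      gcongr

/-- Reconstruction in `V²` of a multiplier `b` from the pieces of a partition of unity, by means of
the multipliers `b a_i / ∑_l a_l²`, whose square sum is bounded. -/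
theorem IsPartition.v2Norm_le_of_lt {ι : Type*} {a : ι → Space d → ℝ} (ha : IsPartition a)
    {M : ℕ} (hM : ∀ ξ, {i | a i ξ ≠ 0}.ncard ≤ M) {b : Space d → ℝ} (hb : IsSymbol b)
    (hb0 : ∀ ξ, 0 ≤ b ξ) (hb1 : ∀ ξ, b ξ ≤ 1) (u : 𝓢'(SpaceTime d, ℂ)) {B : ℝ≥0∞} (hB : B < ⊤)
    (h : ∀ i, (∃ ξ, a i ξ ≠ 0 ∧ b ξ ≠ 0) → v2Norm (spatialMultiplier (a i) u) < B) :
    v2Norm (spatialMultiplier b u) ≤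
      ENNReal.ofReal (√M * √({i | ∃ ξ, a i ξ ≠ 0 ∧ b ξ ≠ 0}.ncard)) * B := by
  classical
  have hfin := ha.finite_meets hb
  set T := hfin.toFinset with hT
  have hmem : ∀ i, i ∈ T ↔ ∃ ξ, a i ξ ≠ 0 ∧ b ξ ≠ 0 := fun i => by simp [T]
  rw [Set.ncard_eq_toFinset_card _ hfin]
  let Q : Space d → ℝ := fun ξ => ∑ᶠ i, a i ξ ^ 2
  have hQ : ∀ ξ, 0 < Q ξ := fun ξ => by
    have h1 := ha.one_le_mul_squareSum (hM ξ)
    by_contra h2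
    have h3 : (M : ℝ) * Q ξ ≤ 0 := mul_nonpos_of_nonneg_of_nonpos (by positivity) (not_lt.1 h2)
    exact absurd (h1.trans h3) (by norm_num)
  have hQs : ∀ ξ, b ξ ≠ 0 → ∑ i ∈ T, a i ξ ^ 2 = Q ξ := fun ξ hξ =>
    (finsum_eq_sum_of_support_subset _ fun i hi =>
      (hmem i).2 ⟨ξ, by simpa using hi, hξ⟩).symm
  have hm : ∀ i, IsSymbol fun ξ => b ξ * a i ξ / Q ξ := fun i =>
    ⟨(hb.smooth.mul (ha.symbol i).smooth).div ha.squareSum_contDiff fun ξ => (hQ ξ).ne', by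
      have := (hb.compact.mul_right (f' := a i)).mul_right (f' := fun ξ => (Q ξ)⁻¹)
      exact this⟩
  have hsum : spatialMultiplier b u = ∑ i ∈ T, spatialMultiplier (fun ξ => b ξ * a i ξ / Q ξ)
      (spatialMultiplier (a i) u) := by
    simp_rw [fun i => spatialMultiplier_comp (hm i) (ha.symbol i) u]
    rw [← spatialMultiplier_sum fun i _ => (hm i).mul (ha.symbol i)]
    congr 1
    ext ξ
    by_cases hξ : b ξ = 0
    · simp [hξ]
    · have : ∀ i, b ξ * a i ξ / Q ξ * a i ξ = b ξ / Q ξ * a i ξ ^ 2 := fun i => by ring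
      simp_rw [this]
      rw [← Finset.mul_sum, hQs ξ hξ, div_mul_cancel₀ _ (hQ ξ).ne']
  -- Representing functions are needed only for the pieces that meet `b`.
  have hex : ∀ i, ∃ w : ℝ → L2 d, i ∈ T →
      Represents w (spatialMultiplier (a i) u) ∧ v2NormFun w < B := fun i => by
    by_cases hi : i ∈ T
    · have := h i ((hmem i).1 hi)
      simp only [v2Norm, iInf_lt_iff] at this
      obtain ⟨w, hw, hw'⟩ := this
      exact ⟨w, fun _ => ⟨hw, hw'⟩⟩
    · exact ⟨0, fun h => absurd h hi⟩
  choose w hw using hex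
  have hrep : Represents (fun t => ∑ i ∈ T, (hm i).multL2 (w i t)) (spatialMultiplier b u) := by
    rw [hsum]
    exact represents_sum T
      (fun i hi => (isTame_of_v2NormFun_lt_top ((hw i hi).2.trans hB)).comp_clm _)
      (fun i hi => represents_spatialMultiplier (hm i) (hw i hi).1)
  refine (v2Norm_le hrep).trans ?_
  refine v2NormFun_sum_le T (fun i => (hm i).multL2) (by positivity)
    (norm_sum_multL2_sq_le T hm fun ξ => ?_) hB fun i hi => (hw i hi).2.le
  by_cases hξ : b ξ = 0
  · simp [hξ]
  · have e : ∀ i, (b ξ * a i ξ / Q ξ) ^ 2 = b ξ ^ 2 / Q ξ ^ 2 * a i ξ ^ 2 := fun i => by ring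
    simp_rw [e]
    rw [← Finset.mul_sum, hQs ξ hξ]
    have hq := hQ ξ
    have h1 := ha.one_le_mul_squareSum (hM ξ)
    have h2 : b ξ ^ 2 ≤ 1 := pow_le_one₀ (hb0 ξ) (hb1 ξ)
    rw [div_mul_eq_mul_div, div_le_iff₀ (by positivity)]
    calc b ξ ^ 2 * Q ξ ≤ 1 * Q ξ := by gcongr
      _ ≤ (M * Q ξ) * Q ξ := by gcongr
      _ = _ := by ring

/-- Comparison of weighted `ℓ^∞(V²)` norms. -/
theorem iSup_v2Norm_le {ι κ : Type*} {a : ι → Space d → ℝ} {b : κ → Space d → ℝ}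
    (ha : IsPartition a) (hb : IsPartition b) {M : ℕ} (hM : ∀ ξ, {i | a i ξ ≠ 0}.ncard ≤ M)
    {W : ι → ℝ} {V : κ → ℝ} {A : ℝ} (hA : 0 ≤ A)
    (h : ∀ i k, (∃ ξ, a i ξ ≠ 0 ∧ b k ξ ≠ 0) →
      √({i | ∃ ξ, a i ξ ≠ 0 ∧ b k ξ ≠ 0}.ncard) * V k ≤ A * W i)
    (u : 𝓢'(SpaceTime d, ℂ))
    (hu : ⨆ i, ENNReal.ofReal (W i) * v2Norm (spatialMultiplier (a i) u) < ⊤) :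
    ⨆ k, ENNReal.ofReal (V k) * v2Norm (spatialMultiplier (b k) u) ≤
      ENNReal.ofReal (√M * A) * ⨆ i, ENNReal.ofReal (W i) * v2Norm (spatialMultiplier (a i) u) := by
  refine iSup_le fun k => ?_
  set Y := ⨆ i, ENNReal.ofReal (W i) * v2Norm (spatialMultiplier (a i) u)
  set N : ℝ := √({i | ∃ ξ, a i ξ ≠ 0 ∧ b k ξ ≠ 0}.ncard) with hN
  have hN0 : 0 ≤ N := Real.sqrt_nonneg _
  rcases le_or_gt (V k) 0 with hV | hV
  · simp [ENNReal.ofReal_of_nonpos hV]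
  -- The bound for the pieces that meet `b k`, rescaled so that it does not depend on the piece.
  have hpiece : ∀ i, (∃ ξ, a i ξ ≠ 0 ∧ b k ξ ≠ 0) →
      ENNReal.ofReal (N * V k) * v2Norm (spatialMultiplier (a i) u) ≤ ENNReal.ofReal A * Y := by
    intro i hi
    calc _ ≤ ENNReal.ofReal (A * W i) * v2Norm (spatialMultiplier (a i) u) := by
          exact mul_le_mul_left (ENNReal.ofReal_le_ofReal (h i k hi)) _
      _ = ENNReal.ofReal A * (ENNReal.ofReal (W i) * v2Norm (spatialMultiplier (a i) u)) := by
          rw [ENNReal.ofReal_mul hA, mul_assoc]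
      _ ≤ _ := by gcongr; exact le_iSup (fun i => ENNReal.ofReal (W i) *
          v2Norm (spatialMultiplier (a i) u)) i
  have hlt := fun B hB => ha.v2Norm_le_of_lt hM (hb.symbol k) (hb.nonneg k) (hb.le_one k) u (B := B)
    hB
  rw [← hN] at hlt
  have hM0 : 0 ≤ √(M : ℝ) := Real.sqrt_nonneg _
  -- If no piece meets `b k`, then `b k` vanishes and so does its multiplier.
  rcases hN0.eq_or_lt with hNz | hNpos
  · have hempty : ∀ i, ¬ ∃ ξ, a i ξ ≠ 0 ∧ b k ξ ≠ 0 := fun i hi => by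
      have h0 : {i | ∃ ξ, a i ξ ≠ 0 ∧ b k ξ ≠ 0}.ncard = 0 := by
        have := (Real.sqrt_eq_zero (by positivity)).1 hNz.symm
        exact_mod_cast this
      have h1 := (Set.ncard_eq_zero (ha.finite_meets (hb.symbol k))).1 h0
      exact (h1 ▸ hi : i ∈ (∅ : Set ι))
    have := hlt 1 ENNReal.one_lt_top fun i hi => absurd hi (hempty i)
    rw [← hNz] at this
    simp only [mul_zero, ENNReal.ofReal_zero, zero_mul, nonpos_iff_eq_zero] at this
    simp [this]
  have hc0 : ENNReal.ofReal (N * V k) ≠ 0 := by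
    rw [ne_eq, ENNReal.ofReal_eq_zero, not_le]; positivity
  set B₀ := ENNReal.ofReal A * Y / ENNReal.ofReal (N * V k) with hB₀
  have hB₀t : B₀ < ⊤ := ENNReal.div_lt_top (by finiteness) hc0
  have hle : ∀ i, (∃ ξ, a i ξ ≠ 0 ∧ b k ξ ≠ 0) → v2Norm (spatialMultiplier (a i) u) ≤ B₀ :=
    fun i hi => by
      rw [hB₀, ENNReal.le_div_iff_mul_le (Or.inl hc0) (Or.inl ENNReal.ofReal_ne_top), mul_comm]
      exact hpiece i hi
  have hfinal : v2Norm (spatialMultiplier (b k) u) ≤ ENNReal.ofReal (√M * N) * B₀ := by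
    rcases hM0.eq_or_lt with hMz | hMpos
    · have := hlt (B₀ + 1) (by finiteness) fun i hi =>
        (hle i hi).trans_lt (ENNReal.lt_add_right hB₀t.ne one_ne_zero)
      rw [← hMz] at this ⊢
      simpa using this
    have hd0 : ENNReal.ofReal (√M * N) ≠ 0 := by
      rw [ne_eq, ENNReal.ofReal_eq_zero, not_le]; positivity
    rw [mul_comm, ← ENNReal.div_le_iff hd0 ENNReal.ofReal_ne_top]
    refine le_of_forall_gt_imp_ge_of_dense fun B hB => ?_
    rcases eq_or_ne B ⊤ with rfl | hBt
    · exact le_top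
    rw [ENNReal.div_le_iff hd0 ENNReal.ofReal_ne_top, mul_comm]
    exact hlt B hBt.lt_top fun i hi => (hle i hi).trans_lt hB
  calc _ ≤ ENNReal.ofReal (V k) * (ENNReal.ofReal (√M * N) * B₀) := by gcongr
    _ = ENNReal.ofReal √M * (ENNReal.ofReal (N * V k) * B₀) := by
        rw [ENNReal.ofReal_mul hM0, ENNReal.ofReal_mul hN0]; ring
    _ = ENNReal.ofReal √M * (ENNReal.ofReal A * Y) := by
        rw [hB₀, ENNReal.mul_div_cancel hc0 ENNReal.ofReal_ne_top]
    _ = _ := by rw [ENNReal.ofReal_mul hM0, mul_assoc]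

/-! ### Geometry of the frequency decompositions -/

/-- The family `a` is adapted to the exponent `γ`, with constant `c`: the set where `a i ≠ 0` lies
within a distance of order `R i ^ γ` from `x i`, and `1 + |ξ|` is of order `R i` there. The dyadic
decomposition is the case `γ = 1`, `x = 0`. -/
structure IsAdapted {ι : Type*} (a : ι → Space d → ℝ) (x : ι → Space d) (R : ι → ℝ) (γ c : ℝ) :
    Prop where
  one_le : ∀ i, 1 ≤ R i
  one_le_const : 1 ≤ c
  near : ∀ i ξ, a i ξ ≠ 0 → ‖ξ - x i‖ ≤ c * R i ^ γ
  upper : ∀ i ξ, a i ξ ≠ 0 → 1 + ‖ξ‖ ≤ c * R i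
  lower : ∀ i ξ, a i ξ ≠ 0 → R i ≤ c * (1 + ‖ξ‖)

theorem IsAdapted.locallyFinite {ι : Type*} {a : ι → Space d → ℝ} {x : ι → Space d} {R : ι → ℝ}
    {γ c : ℝ} (h : IsAdapted a x R γ c) (hR : ∀ D, {i | R i ≤ D}.Finite) :
    LocallyFinite fun i => Function.support (a i) := by
  intro ξ₀
  refine ⟨Metric.ball ξ₀ 1, Metric.ball_mem_nhds _ one_pos, (hR (c * (2 + ‖ξ₀‖))).subset ?_⟩
  rintro i ⟨ξ, hξ, hb⟩
  have h1 := h.lower i ξ hξ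
  have h2 : ‖ξ‖ ≤ 1 + ‖ξ₀‖ := by
    have h3 : ‖ξ - ξ₀‖ < 1 := by simpa [dist_eq_norm] using hb
    have h4 := norm_le_norm_add_norm_sub' ξ ξ₀
    linarith
  have hc := h.one_le_const
  have h5 : c * (1 + ‖ξ‖) ≤ c * (2 + ‖ξ₀‖) := mul_le_mul_of_nonneg_left (by linarith) (by linarith)
  exact h1.trans h5

theorem one_le_bracket (k : Fin d → ℤ) : 1 ≤ bracket k :=
  Real.one_le_sqrt.2 (by simp)

theorem norm_latticePt_le_bracket (k : Fin d → ℤ) : ‖latticePt k‖ ≤ bracket k :=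
  Real.le_sqrt_of_sq_le (by linarith)

theorem bracket_le (k : Fin d → ℤ) : bracket k ≤ 1 + ‖latticePt k‖ := by
  rw [bracket, Real.sqrt_le_left (by positivity)]
  nlinarith [norm_nonneg (latticePt k)]

theorem norm_le_norm_of_bracket_le {k l : Fin d → ℤ} (h : bracket k ≤ bracket l) :
    ‖latticePt k‖ ≤ ‖latticePt l‖ := by
  by_contra h'
  have h1 : bracket l < bracket k := by
    refine Real.sqrt_lt_sqrt (by positivity) ?_
    have := pow_lt_pow_left₀ (not_le.1 h') (norm_nonneg _) two_ne_zero
    linarith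
  exact absurd h (not_le.2 h1)

/-- A set of lattice points of diameter at most `D` lies in a cube of side `2D`. -/
theorem lattice_card_le {S : Set (Fin d → ℤ)} {D : ℝ} (hD : 0 ≤ D)
    (h : ∀ k ∈ S, ∀ l ∈ S, ‖latticePt k - latticePt l‖ ≤ D) :
    S.Finite ∧ (S.ncard : ℝ) ≤ (2 * D + 1) ^ d := by
  rcases S.eq_empty_or_nonempty with rfl | ⟨l, hl⟩
  · simp only [Set.finite_empty, Set.ncard_empty, Nat.cast_zero, true_and]
    positivity
  let F : Finset (Fin d → ℤ) := Fintype.piFinset fun i => Finset.Icc (l i - ⌊D⌋) (l i + ⌊D⌋)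
  have hF : S ⊆ F := by
    intro k hk
    simp only [F, Finset.mem_coe, Fintype.mem_piFinset, Finset.mem_Icc]
    intro i
    have h1 : |((k i - l i : ℤ) : ℝ)| ≤ D := by
      refine le_trans ?_ (h k hk l hl)
      have := PiLp.norm_apply_le (latticePt k - latticePt l) i
      simpa [latticePt] using this
    have h2 : |k i - l i| ≤ ⌊D⌋ := Int.le_floor.2 (by exact_mod_cast h1)
    have := abs_le.1 h2
    constructor <;> linarith [this.1, this.2]
  refine ⟨F.finite_toSet.subset hF, ?_⟩
  have h1 : S.ncard ≤ F.card := by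
    rw [← Set.ncard_coe_finset F]
    exact Set.ncard_le_ncard hF F.finite_toSet
  have hfl : 0 ≤ ⌊D⌋ := Int.floor_nonneg.2 hD
  have h2 : F.card = (2 * ⌊D⌋ + 1).toNat ^ d := by
    rw [Fintype.card_piFinset]
    have : ∀ i : Fin d, (Finset.Icc (l i - ⌊D⌋) (l i + ⌊D⌋)).card = (2 * ⌊D⌋ + 1).toNat := by
      intro i
      rw [Int.card_Icc]
      congr 1
      ring
    simp [this]
  calc (S.ncard : ℝ) ≤ F.card := by exact_mod_cast h1
    _ = (((2 * ⌊D⌋ + 1).toNat : ℤ) : ℝ) ^ d := by rw [h2]; push_cast; rfl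
    _ = (2 * (⌊D⌋ : ℝ) + 1) ^ d := by
      rw [Int.toNat_of_nonneg (by linarith)]; push_cast; rfl
    _ ≤ _ := by
      have : (0 : ℝ) ≤ ⌊D⌋ := by exact_mod_cast hfl
      gcongr
      exact Int.floor_le D

/-- The centre `⟨k⟩^{α/(1-α)} k` of the `k`-th piece of the `α`-decomposition. -/
def centre (α : ℝ) (k : Fin d → ℤ) : Space d := bracket k ^ (α / (1 - α)) • latticePt k

/-- The size `⟨k⟩^{1/(1-α)}` of the frequencies in the `k`-th piece of the `α`-decomposition. -/
def scale (α : ℝ) (k : Fin d → ℤ) : ℝ := bracket k ^ (1 / (1 - α))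

theorem one_le_scale {α : ℝ} (h1 : α < 1) (k : Fin d → ℤ) : 1 ≤ scale α k :=
  Real.one_le_rpow (one_le_bracket k) (by have : 0 < 1 - α := by linarith
                                          positivity)

theorem scale_rpow (α s : ℝ) (k : Fin d → ℤ) : scale α k ^ s = bracket k ^ (s / (1 - α)) := by
  rw [scale, ← Real.rpow_mul (by linarith [one_le_bracket k])]
  congr 1
  ring

theorem bracket_rpow_mul {α : ℝ} (h1 : α < 1) (k : Fin d → ℤ) :
    bracket k ^ (α / (1 - α)) * bracket k = scale α k := by
  have hb := one_le_bracket k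
  have : 1 - α ≠ 0 := by linarith
  rw [scale, ← Real.rpow_add_one (by linarith)]
  congr 1
  field_simp
  ring

/-- The map `k ↦ ⟨k⟩^{α/(1-α)} k` expands distances at least by the smaller of the two factors,
since the factor increases with `|k|`. -/
theorem centre_separated {α : ℝ} (h0 : 0 ≤ α) (h1 : α < 1) {k l : Fin d → ℤ}
    (h : bracket l ≤ bracket k) :
    scale α l ^ α * ‖latticePt k - latticePt l‖ ≤ ‖centre α k - centre α l‖ := by
  rw [scale_rpow]
  set p := latticePt k
  set q := latticePt l
  set P := bracket k ^ (α / (1 - α)) with hP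
  set Q := bracket l ^ (α / (1 - α)) with hQ
  have hl := one_le_bracket l
  have hQ0 : 0 ≤ Q := by positivity
  have hPQ : Q ≤ P := Real.rpow_le_rpow (by linarith) h (div_nonneg h0 (by linarith))
  have hn : ‖q‖ ≤ ‖p‖ := norm_le_norm_of_bracket_le h
  have hc : centre α k - centre α l = P • p - Q • q := rfl
  rw [hc]
  rcases eq_or_ne (p - q) 0 with h0 | h0
  · rw [h0, norm_zero, mul_zero]; exact norm_nonneg _
  have hpos : 0 < ‖p - q‖ := norm_pos_iff.2 h0
  have h2 : 0 ≤ inner ℝ p (p - q) := by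
    rw [inner_sub_right, real_inner_self_eq_norm_sq]
    have := real_inner_le_norm p q
    nlinarith [norm_nonneg p, norm_nonneg q]
  have h3 : Q * ‖p - q‖ ^ 2 ≤ inner ℝ (P • p - Q • q) (p - q) := by
    have e : P • p - Q • q = Q • (p - q) + (P - Q) • p := by
      rw [smul_sub, sub_smul]; abel
    rw [e, inner_add_left, real_inner_smul_left, real_inner_smul_left, real_inner_self_eq_norm_sq]
    have := mul_nonneg (sub_nonneg.2 hPQ) h2
    linarith
  have h4 := real_inner_le_norm (P • p - Q • q) (p - q)
  have h5 : (Q * ‖p - q‖) * ‖p - q‖ ≤ ‖P • p - Q • q‖ * ‖p - q‖ := by nlinarith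
  exact le_of_mul_le_mul_right h5 hpos

/-- Counting: the number of pieces of size at least of order `R` with centre in a ball of radius of
order `R^γ` is `O(R^{d(γ-α)})`. -/
theorem centre_card_le {α γ K c R : ℝ} (h0 : 0 ≤ α) (h1 : α < 1) (hγ : α ≤ γ) (hK : 0 ≤ K)
    (hc : 1 ≤ c) (hR : 1 ≤ R) {S : Set (Fin d → ℤ)} (hS : ∀ k ∈ S, R ≤ c * scale α k)
    (y : Space d) (hy : ∀ k ∈ S, ‖centre α k - y‖ ≤ K * R ^ γ) :
    S.Finite ∧ (S.ncard : ℝ) ≤ ((4 * K * c + 1) * R ^ (γ - α)) ^ d := by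
  have hsc : ∀ k ∈ S, R ^ α ≤ c * scale α k ^ α := fun k hk => by
    have hk0 : 0 ≤ scale α k := zero_le_one.trans (one_le_scale h1 k)
    calc R ^ α ≤ (c * scale α k) ^ α := Real.rpow_le_rpow (by linarith) (hS k hk) h0
      _ = c ^ α * scale α k ^ α := Real.mul_rpow (by linarith) hk0
      _ ≤ c * scale α k ^ α := by
        gcongr
        exact (Real.rpow_le_rpow_of_exponent_le hc h1.le).trans_eq (Real.rpow_one c)
  have hRα : 0 < R ^ α := Real.rpow_pos_of_pos (by linarith) _
  have hsep : ∀ k ∈ S, ∀ l ∈ S, bracket l ≤ bracket k →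
      ‖latticePt k - latticePt l‖ ≤ 2 * K * c * R ^ (γ - α) := fun k hk l hl hkl => by
    have h2 := centre_separated h0 h1 hkl
    have h3 : ‖centre α k - centre α l‖ ≤ 2 * K * R ^ γ := by
      have e : centre α k - centre α l = (centre α k - y) - (centre α l - y) := by abel
      rw [e]
      refine (norm_sub_le _ _).trans ?_
      linarith [hy k hk, hy l hl]
    have h4 : R ^ γ = R ^ α * R ^ (γ - α) := by
      rw [← Real.rpow_add (by linarith)]; congr 1; ring
    have h5 : R ^ α * ‖latticePt k - latticePt l‖ ≤ R ^ α * (2 * K * c * R ^ (γ - α)) := by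
      calc R ^ α * ‖latticePt k - latticePt l‖
          ≤ c * scale α l ^ α * ‖latticePt k - latticePt l‖ := by gcongr; exact hsc l hl
        _ = c * (scale α l ^ α * ‖latticePt k - latticePt l‖) := by ring
        _ ≤ c * (2 * K * R ^ γ) := mul_le_mul_of_nonneg_left (h2.trans h3) (by linarith)
        _ = _ := by rw [h4]; ring
    exact le_of_mul_le_mul_left h5 hRα
  have hRγ : 1 ≤ R ^ (γ - α) := Real.one_le_rpow hR (by linarith)
  obtain ⟨h2, h3⟩ := lattice_card_le (S := S) (D := 2 * K * c * R ^ (γ - α)) (by positivity)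
    fun k hk l hl => by
      rcases le_total (bracket l) (bracket k) with h | h
      · exact hsep k hk l hl h
      · rw [norm_sub_rev]; exact hsep l hl k hk h
  refine ⟨h2, h3.trans ?_⟩
  gcongr
  linarith

theorem scale_finite {α : ℝ} (h0 : 0 ≤ α) (h1 : α < 1) (D : ℝ) :
    {k : Fin d → ℤ | scale α k ≤ D}.Finite := by
  have hb : ∀ k : Fin d → ℤ, scale α k ≤ D → ‖latticePt k‖ ≤ |D| := fun k hk => by
    refine (norm_latticePt_le_bracket k).trans (le_trans ?_ (hk.trans (le_abs_self D)))
    rw [← bracket_rpow_mul h1]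
    exact le_mul_of_one_le_left (by linarith [one_le_bracket k])
      (Real.one_le_rpow (one_le_bracket k) (div_nonneg h0 (by linarith)))
  refine (lattice_card_le (D := |D| + |D|) (by positivity) fun k hk l hl => ?_).1
  exact (norm_sub_le _ _).trans (add_le_add (hb k hk) (hb l hl))

theorem rpow_le_of_comparable {c x y : ℝ} (hc : 1 ≤ c) (hx : 1 ≤ x) (hy : 1 ≤ y)
    (hxy : x ≤ c * y) (hyx : y ≤ c * x) (s : ℝ) : x ^ s ≤ c ^ |s| * y ^ s := by
  rcases le_total 0 s with hs | hs
  · rw [abs_of_nonneg hs, ← Real.mul_rpow (by linarith) (by linarith)]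
    exact Real.rpow_le_rpow (by linarith) hxy hs
  · have h1 : (c * x) ^ s ≤ y ^ s := Real.rpow_le_rpow_of_nonpos (by linarith) hyx hs
    rw [Real.mul_rpow (by linarith) (by linarith)] at h1
    have h2 : c ^ |s| * c ^ s = 1 := by
      rw [← Real.rpow_add (by linarith), abs_of_nonpos hs]; simp
    calc x ^ s = c ^ |s| * (c ^ s * x ^ s) := by rw [← mul_assoc, h2, one_mul]
      _ ≤ _ := by gcongr

/-- The number of pieces of an `α`-decomposition that meet a given piece of another family. -/
theorem sqrt_card_meets_le {ι : Type*} {a : ι → Space d → ℝ} {x : ι → Space d} {R : ι → ℝ}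
    {γ c : ℝ} (ha : IsAdapted a x R γ c) {b : (Fin d → ℤ) → Space d → ℝ} {α c' : ℝ}
    (h0 : 0 ≤ α) (h1 : α < 1) (hb : IsAdapted b (centre α) (scale α) α c') :
    ∃ K : ℝ, 0 ≤ K ∧ ∀ i, √({k | ∃ ξ, b k ξ ≠ 0 ∧ a i ξ ≠ 0}.ncard) ≤
      K * R i ^ (d * (max α γ - α) / 2) := by
  have hc := ha.one_le_const
  have hc' := hb.one_le_const
  refine ⟨(4 * (c' * (c' * c) + c) * (c * c') + 1) ^ d, by positivity, fun i => ?_⟩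
  have hR := ha.one_le i
  obtain ⟨-, h2⟩ := centre_card_le (S := {k | ∃ ξ, b k ξ ≠ 0 ∧ a i ξ ≠ 0}) (R := R i)
    (K := c' * (c' * c) + c) (c := c * c') (γ := max α γ) h0 h1
    (le_max_left _ _) (by positivity) (one_le_mul_of_one_le_of_one_le hc hc') hR (by
      rintro k ⟨ξ, hk, hi⟩
      calc R i ≤ c * (1 + ‖ξ‖) := ha.lower i ξ hi
        _ ≤ c * (c' * scale α k) := by gcongr; exact hb.upper k ξ hk
        _ = _ := by ring) (x i) (by
      rintro k ⟨ξ, hk, hi⟩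
      have hs := one_le_scale h1 k
      have h3 : scale α k ≤ c' * c * R i := by
        calc scale α k ≤ c' * (1 + ‖ξ‖) := hb.lower k ξ hk
          _ ≤ c' * (c * R i) := by gcongr; exact ha.upper i ξ hi
          _ = _ := by ring
      have h4 : scale α k ^ α ≤ c' * c * R i ^ α := by
        calc scale α k ^ α ≤ (c' * c * R i) ^ α := Real.rpow_le_rpow (by linarith) h3 h0
          _ = (c' * c) ^ α * R i ^ α := Real.mul_rpow (by positivity) (by linarith)
          _ ≤ _ := by
            gcongr
            exact (Real.rpow_le_rpow_of_exponent_le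
              (one_le_mul_of_one_le_of_one_le hc' hc) h1.le).trans_eq (Real.rpow_one _)
      have e : centre α k - x i = (ξ - x i) - (ξ - centre α k) := by abel
      rw [e]
      calc _ ≤ ‖ξ - x i‖ + ‖ξ - centre α k‖ := norm_sub_le _ _
        _ ≤ c * R i ^ γ + c' * (c' * c * R i ^ α) := by
          gcongr
          · exact ha.near i ξ hi
          · exact (hb.near k ξ hk).trans (by gcongr)
        _ ≤ c * R i ^ (max α γ) + c' * (c' * c * R i ^ (max α γ)) := by
          gcongr
          · exact le_max_right _ _
          · exact le_max_left _ _
        _ = _ := by ring)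
  set H := 4 * (c' * (c' * c) + c) * (c * c') + 1
  have hH : 1 ≤ H := le_add_of_nonneg_left (by positivity)
  rw [Real.sqrt_le_left (by positivity)]
  refine h2.trans ?_
  rw [mul_pow, mul_pow, ← pow_mul, ← Real.rpow_natCast (R i ^ _) d, ← Real.rpow_natCast (R i ^ _) 2,
    ← Real.rpow_mul (by linarith), ← Real.rpow_mul (by linarith)]
  have e : (d * (max α γ - α) / 2) * ((2 : ℕ) : ℝ) = (max α γ - α) * d := by push_cast; ring
  rw [e]
  gcongr
  omega

/-- The pieces of an `α`-decomposition have bounded overlap. -/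
theorem IsAdapted.exists_overlap {b : (Fin d → ℤ) → Space d → ℝ} {α c : ℝ}
    (h0 : 0 ≤ α) (h1 : α < 1) (hb : IsAdapted b (centre α) (scale α) α c) :
    ∃ M : ℕ, ∀ ξ, {k | b k ξ ≠ 0}.ncard ≤ M := by
  have hc := hb.one_le_const
  refine ⟨⌈(4 * (c * c) * c + 1) ^ d⌉₊, fun ξ => ?_⟩
  obtain ⟨-, h2⟩ := centre_card_le (S := {k | b k ξ ≠ 0}) (R := 1 + ‖ξ‖) (K := c * c) (c := c)
    (γ := α) h0 h1 le_rfl (by positivity) hc (by simp) (fun k hk => hb.upper k ξ hk) ξ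
    (fun k hk => by
      have hs := one_le_scale h1 k
      have h4 : scale α k ^ α ≤ c * (1 + ‖ξ‖) ^ α := by
        calc scale α k ^ α ≤ (c * (1 + ‖ξ‖)) ^ α :=
              Real.rpow_le_rpow (by linarith) (hb.lower k ξ hk) h0
          _ = c ^ α * (1 + ‖ξ‖) ^ α := Real.mul_rpow (by positivity) (by positivity)
          _ ≤ _ := by
            gcongr
            exact (Real.rpow_le_rpow_of_exponent_le hc h1.le).trans_eq (Real.rpow_one _)
      rw [norm_sub_rev]
      calc _ ≤ c * scale α k ^ α := hb.near k ξ hk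
        _ ≤ c * (c * (1 + ‖ξ‖) ^ α) := by gcongr
        _ = _ := by ring)
  rw [sub_self, Real.rpow_zero, mul_one] at h2
  exact_mod_cast h2.trans (Nat.le_ceil _)

/-- The condition on the weights that makes `tsum_u2Norm_le` applicable. -/
theorem exists_weight_le_left {ι : Type*} {a : ι → Space d → ℝ} {x : ι → Space d} {R : ι → ℝ}
    {γ c : ℝ} (ha : IsAdapted a x R γ c) {b : (Fin d → ℤ) → Space d → ℝ} {α c' s₁ s₂ : ℝ}
    (h0 : 0 ≤ α) (h1 : α < 1) (hb : IsAdapted b (centre α) (scale α) α c')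
    (hs : s₂ + d * (max α γ - α) / 2 ≤ s₁) :
    ∃ A : ℝ, 0 ≤ A ∧ ∀ i k, (∃ ξ, b k ξ ≠ 0 ∧ a i ξ ≠ 0) →
      √({k | ∃ ξ, b k ξ ≠ 0 ∧ a i ξ ≠ 0}.ncard) * scale α k ^ s₂ ≤ A * R i ^ s₁ := by
  obtain ⟨K, hK, hcard⟩ := sqrt_card_meets_le ha h0 h1 hb
  have hc := ha.one_le_const
  have hc' := hb.one_le_const
  refine ⟨K * (c * c') ^ |s₂|, by positivity, fun i k ⟨ξ, hk, hi⟩ => ?_⟩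
  have hR := ha.one_le i
  have hs2 := rpow_le_of_comparable (one_le_mul_of_one_le_of_one_le hc hc') (hb.one_le k) hR
    (by calc scale α k ≤ c' * (1 + ‖ξ‖) := hb.lower k ξ hk
          _ ≤ c' * (c * R i) := by gcongr; exact ha.upper i ξ hi
          _ = _ := by ring)
    (by calc R i ≤ c * (1 + ‖ξ‖) := ha.lower i ξ hi
          _ ≤ c * (c' * scale α k) := by gcongr; exact hb.upper k ξ hk
          _ = _ := by ring) s₂
  calc _ ≤ K * R i ^ (d * (max α γ - α) / 2) * ((c * c') ^ |s₂| * R i ^ s₂) :=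
        mul_le_mul (hcard i) hs2 (Real.rpow_nonneg (zero_le_one.trans (hb.one_le k)) _)
          (by positivity)
    _ = K * (c * c') ^ |s₂| * R i ^ (s₂ + d * (max α γ - α) / 2) := by
        rw [Real.rpow_add (by linarith)]; ring
    _ ≤ _ := by gcongr

/-- The condition on the weights that makes `iSup_v2Norm_le` applicable. -/
theorem exists_weight_le_right {κ : Type*} {b : κ → Space d → ℝ} {x : κ → Space d} {R : κ → ℝ}
    {γ c : ℝ} (hb : IsAdapted b x R γ c) {a : (Fin d → ℤ) → Space d → ℝ} {α c' s₁ s₂ : ℝ}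
    (h0 : 0 ≤ α) (h1 : α < 1) (ha : IsAdapted a (centre α) (scale α) α c')
    (hs : s₂ + d * (max α γ - α) / 2 ≤ s₁) :
    ∃ A : ℝ, 0 ≤ A ∧ ∀ i k, (∃ ξ, a i ξ ≠ 0 ∧ b k ξ ≠ 0) →
      √({i | ∃ ξ, a i ξ ≠ 0 ∧ b k ξ ≠ 0}.ncard) * R k ^ s₂ ≤ A * scale α i ^ s₁ := by
  obtain ⟨K, hK, hcard⟩ := sqrt_card_meets_le hb h0 h1 ha
  have hc := hb.one_le_const
  have hc' := ha.one_le_const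
  refine ⟨K * (c * c') ^ |s₁|, by positivity, fun i k ⟨ξ, hi, hk⟩ => ?_⟩
  have hR := hb.one_le k
  have hs1 := rpow_le_of_comparable (one_le_mul_of_one_le_of_one_le hc hc') hR (ha.one_le i)
    (by calc R k ≤ c * (1 + ‖ξ‖) := hb.lower k ξ hk
          _ ≤ c * (c' * scale α i) := by gcongr; exact ha.upper i ξ hi
          _ = _ := by ring)
    (by calc scale α i ≤ c' * (1 + ‖ξ‖) := ha.lower i ξ hi
          _ ≤ c' * (c * R k) := by gcongr; exact hb.upper k ξ hk
          _ = _ := by ring) s₁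
  calc _ ≤ K * R k ^ (d * (max α γ - α) / 2) * R k ^ s₂ := by
        gcongr
        exact hcard k
    _ = K * R k ^ (s₂ + d * (max α γ - α) / 2) := by
        rw [Real.rpow_add (by linarith)]; ring
    _ ≤ K * R k ^ s₁ := by gcongr
    _ ≤ K * ((c * c') ^ |s₁| * scale α i ^ s₁) := by gcongr
    _ = _ := by ring

/-! ### The `α`-decomposition and the dyadic decomposition -/

theorem norm_sub_centre_lt {φ : Space d → ℝ} (hφ : IsRadialBump φ) {C α : ℝ} (hC : 0 < C)
    {k : Fin d → ℤ} {ξ : Space d} (h : alphaBump φ C α k ξ ≠ 0) :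
    ‖ξ - centre α k‖ < 2 * C * scale α k ^ α := by
  rw [scale_rpow]
  have hr : 0 < C * bracket k ^ (α / (1 - α)) :=
    mul_pos hC (Real.rpow_pos_of_pos (by linarith [one_le_bracket k]) _)
  by_contra h'
  refine h (hφ.eq_zero _ ?_)
  rw [norm_smul, norm_inv, Real.norm_of_nonneg hr.le, ← div_eq_inv_mul, le_div_iff₀ hr]
  rw [not_lt] at h'
  refine le_trans (le_of_eq ?_) h'
  ring

theorem isAdapted_alphaBump {φ : Space d → ℝ} (hφ : IsRadialBump φ) {C α : ℝ} (hC : 0 < C)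
    (h0 : 0 ≤ α) (h1 : α < 1) :
    ∃ c, IsAdapted (alphaBump φ C α) (centre α) (scale α) α c := by
  have he : 0 < 1 / (1 - α) := by
    have : 0 < 1 - α := by linarith
    positivity
  have hB0 : (0 : ℝ) ≤ (2 * (1 + 2 * C)) ^ (1 / (1 - α)) := by positivity
  -- Common facts: the centre has norm `r |k|` and the piece has radius `2 C r`, `r = ⟨k⟩^{α/(1-α)}`.
  have basic : ∀ k ξ, alphaBump φ C α k ξ ≠ 0 → 1 ≤ scale α k ^ α ∧
      scale α k ^ α * bracket k = scale α k ∧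
      |‖ξ‖ - scale α k ^ α * ‖latticePt k‖| ≤ 2 * C * scale α k ^ α := by
    intro k ξ h
    have hr : 1 ≤ scale α k ^ α := Real.one_le_rpow (one_le_scale h1 k) h0
    refine ⟨hr, by rw [scale_rpow]; exact bracket_rpow_mul h1 k, ?_⟩
    have h2 := (norm_sub_centre_lt hφ hC h).le
    have h3 : ‖centre α k‖ = scale α k ^ α * ‖latticePt k‖ := by
      rw [centre, norm_smul, ← scale_rpow, Real.norm_of_nonneg (by linarith)]
    rw [← h3]
    exact (abs_norm_sub_norm_le _ _).trans h2
  refine ⟨2 + 2 * C + (2 * (1 + 2 * C)) ^ (1 / (1 - α)), fun k => one_le_scale h1 k,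
    by linarith, fun k ξ h => ?_, fun k ξ h => ?_, fun k ξ h => ?_⟩
  · have := norm_sub_centre_lt hφ hC h
    obtain ⟨hr, -, -⟩ := basic k ξ h
    refine this.le.trans ?_
    gcongr
    linarith
  · obtain ⟨hr, hR, hab⟩ := basic k ξ h
    have h2 := (abs_le.1 hab).2
    have hs := one_le_scale h1 k
    have hb := one_le_bracket k
    have h3 := norm_latticePt_le_bracket k
    have h4 : scale α k ^ α * ‖latticePt k‖ ≤ scale α k :=
      (mul_le_mul_of_nonneg_left h3 (by linarith)).trans_eq hR
    have h5 : scale α k ^ α ≤ scale α k := by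
      nlinarith
    nlinarith
  · obtain ⟨hr, hR, hab⟩ := basic k ξ h
    have h2 := (abs_le.1 hab).1
    have h3 := bracket_le k
    have h4 : scale α k ≤ ‖ξ‖ + (1 + 2 * C) * scale α k ^ α := by nlinarith
    -- For large `k` the centre dominates the radius; the remaining `k` have bounded size.
    rcases le_total (2 * (1 + 2 * C)) (bracket k) with hk | hk
    · have h5 : (1 + 2 * C) * scale α k ^ α ≤ scale α k / 2 := by nlinarith
      have h6 : scale α k ≤ 2 * (1 + ‖ξ‖) := by linarith [norm_nonneg ξ]
      refine h6.trans ?_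
      gcongr
      linarith
    · have h5 : scale α k ≤ (2 * (1 + 2 * C)) ^ (1 / (1 - α)) :=
        Real.rpow_le_rpow (by linarith [one_le_bracket k]) hk he.le
      have h6 := norm_nonneg ξ
      nlinarith

theorem IsAdapted.mono_support {ι : Type*} {a b : ι → Space d → ℝ} {x : ι → Space d} {R : ι → ℝ}
    {γ c : ℝ} (h : IsAdapted a x R γ c) (hab : ∀ i ξ, b i ξ ≠ 0 → a i ξ ≠ 0) :
    IsAdapted b x R γ c :=
  ⟨h.one_le, h.one_le_const, fun i ξ hi => h.near i ξ (hab i ξ hi),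
    fun i ξ hi => h.upper i ξ (hab i ξ hi), fun i ξ hi => h.lower i ξ (hab i ξ hi)⟩

theorem alphaBump_ne_zero_of_alphaCutoff {φ : Space d → ℝ} {C α : ℝ} (k : Fin d → ℤ) (ξ : Space d)
    (h : alphaCutoff φ C α k ξ ≠ 0) : alphaBump φ C α k ξ ≠ 0 := left_ne_zero_of_mul h

theorem isAdapted_alphaCutoff {φ : Space d → ℝ} (hφ : IsRadialBump φ) {C α : ℝ} (hC : 0 < C)
    (h0 : 0 ≤ α) (h1 : α < 1) :
    ∃ c, IsAdapted (alphaCutoff φ C α) (centre α) (scale α) α c := by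
  obtain ⟨c, h⟩ := isAdapted_alphaBump hφ hC h0 h1
  exact ⟨c, h.mono_support alphaBump_ne_zero_of_alphaCutoff⟩

theorem isPartition_alphaCutoff {φ : Space d → ℝ} (hφ : IsRadialBump φ) {C α : ℝ}
    (hC : IsAdmissible φ C α) (h0 : 0 ≤ α) (h1 : α < 1) : IsPartition (alphaCutoff φ C α) := by
  obtain ⟨c, had⟩ := isAdapted_alphaBump hφ hC.1 h0 h1
  have hlf := had.locallyFinite (scale_finite h0 h1)
  have hsm : ∀ k, ContDiff ℝ ∞ (alphaBump φ C α k) := fun k =>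
    hφ.smooth.comp ((contDiff_id.sub contDiff_const).const_smul _)
  have hsum : ∀ ξ, alphaBumpSum φ C α ξ = ∑ᶠ k, alphaBump φ C α k ξ := fun ξ =>
    tsum_eq_finsum (hlf.point_finite ξ)
  have hsumsm : ContDiff ℝ ∞ (alphaBumpSum φ C α) := by
    rw [funext hsum, ← contMDiff_iff_contDiff]
    exact contMDiff_finsum (fun k => contMDiff_iff_contDiff.2 (hsm k)) hlf
  refine ⟨fun k => ⟨(hsm k).mul (hsumsm.inv hC.2), ?_⟩, fun k ξ => ?_, ?_, fun ξ => ?_⟩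
  · refine HasCompactSupport.mul_right ?_
    refine HasCompactSupport.intro
      (isCompact_closedBall (centre α k) (2 * C * scale α k ^ α)) fun ξ hξ => ?_
    by_contra h
    exact hξ (by simpa [dist_eq_norm] using (norm_sub_centre_lt hφ hC.1 h).le)
  · refine mul_nonneg (hφ.nonneg _) (inv_nonneg.2 ?_)
    rw [hsum]
    exact finsum_nonneg fun k => hφ.nonneg _
  · exact hlf.subset fun k ξ hξ => alphaBump_ne_zero_of_alphaCutoff k ξ hξ
  · simp only [alphaCutoff]
    rw [← finsum_mul, ← hsum]
    exact mul_inv_cancel₀ (hC.2 ξ)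

theorem dyadicCutoff_sum (φ : Space d → ℝ) (n : ℕ) (ξ : Space d) :
    ∑ j ∈ Finset.range (n + 1), dyadicCutoff φ j ξ = φ (((2 : ℝ) ^ n)⁻¹ • ξ) := by
  induction n with
  | zero => simp [dyadicCutoff]
  | succ n ih => rw [Finset.sum_range_succ, ih, dyadicCutoff]; ring

theorem bump_scaled_eq_one {φ : Space d → ℝ} (hφ : IsRadialBump φ) {n : ℕ} {ξ : Space d}
    (h : ‖ξ‖ < 2 ^ n) : φ (((2 : ℝ) ^ n)⁻¹ • ξ) = 1 := by
  refine hφ.eq_one _ ?_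
  rw [norm_smul, norm_inv, Real.norm_of_nonneg (by positivity), ← div_eq_inv_mul,
    div_lt_one (by positivity)]
  exact h

theorem bump_scaled_eq_zero {φ : Space d → ℝ} (hφ : IsRadialBump φ) {n : ℕ} {ξ : Space d}
    (h : 2 ^ (n + 1) ≤ ‖ξ‖) : φ (((2 : ℝ) ^ n)⁻¹ • ξ) = 0 := by
  refine hφ.eq_zero _ ?_
  rw [norm_smul, norm_inv, Real.norm_of_nonneg (by positivity), ← div_eq_inv_mul,
    le_div_iff₀ (by positivity), mul_comm, ← pow_succ]
  exact h

theorem dyadicCutoff_upper {φ : Space d → ℝ} (hφ : IsRadialBump φ) {j : ℕ} {ξ : Space d}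
    (h : dyadicCutoff φ j ξ ≠ 0) : ‖ξ‖ ≤ 2 ^ (j + 1) := by
  by_contra h'
  rw [not_le] at h'
  refine h ?_
  cases j with
  | zero => exact hφ.eq_zero ξ (by simpa using h'.le)
  | succ j =>
    have h2 : (2 : ℝ) ^ (j + 1) ≤ 2 ^ (j + 1 + 1) := by gcongr <;> simp
    rw [dyadicCutoff, bump_scaled_eq_zero hφ h'.le, bump_scaled_eq_zero hφ (h2.trans h'.le),
      sub_zero]

theorem dyadicCutoff_lower {φ : Space d → ℝ} (hφ : IsRadialBump φ) {j : ℕ} {ξ : Space d}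
    (h : dyadicCutoff φ (j + 1) ξ ≠ 0) : 2 ^ j ≤ ‖ξ‖ := by
  by_contra h'
  rw [not_le] at h'
  have h2 : (2 : ℝ) ^ j ≤ 2 ^ (j + 1) := by gcongr <;> simp
  refine h ?_
  rw [dyadicCutoff, bump_scaled_eq_one hφ h', bump_scaled_eq_one hφ (h'.trans_le h2), sub_self]

theorem isAdapted_dyadicCutoff {φ : Space d → ℝ} (hφ : IsRadialBump φ) :
    IsAdapted (dyadicCutoff φ) (fun _ => 0) (fun j => (2 : ℝ) ^ j) 1 3 := by
  refine ⟨fun j => one_le_pow₀ (by norm_num), by norm_num, fun j ξ h => ?_, fun j ξ h => ?_,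
    fun j ξ h => ?_⟩
  all_goals have h1 : (1 : ℝ) ≤ 2 ^ j := one_le_pow₀ (by norm_num)
  · have h2 := dyadicCutoff_upper hφ h
    rw [pow_succ] at h2
    rw [sub_zero, Real.rpow_one]
    linarith
  · have h2 := dyadicCutoff_upper hφ h
    rw [pow_succ] at h2
    linarith
  · cases j with
    | zero => linarith [norm_nonneg ξ, pow_zero (2 : ℝ)]
    | succ j =>
      have h2 := dyadicCutoff_lower hφ h
      rw [pow_succ]
      linarith [norm_nonneg ξ]

theorem isPartition_dyadicCutoff {φ : Space d → ℝ} (hφ : IsRadialBump φ) :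
    IsPartition (dyadicCutoff φ) := by
  have hsc : ∀ n : ℕ, ContDiff ℝ ∞ fun ξ => φ (((2 : ℝ) ^ n)⁻¹ • ξ) := fun n =>
    hφ.smooth.comp (contDiff_const_smul _)
  refine ⟨fun j => ⟨?_, ?_⟩, fun j ξ => ?_, ?_, fun ξ => ?_⟩
  · cases j with
    | zero => exact hφ.smooth
    | succ j => exact (hsc (j + 1)).sub (hsc j)
  · refine HasCompactSupport.intro (isCompact_closedBall 0 (2 ^ (j + 1))) fun ξ hξ => ?_
    by_contra h
    exact hξ (by simpa using dyadicCutoff_upper hφ h)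
  · cases j with
    | zero => exact hφ.nonneg ξ
    | succ j =>
      -- `φ` need not be radially decreasing: one of the two terms is always at its extreme value.
      rw [dyadicCutoff, sub_nonneg]
      rcases lt_or_ge ‖ξ‖ (2 ^ (j + 1)) with h | h
      · rw [bump_scaled_eq_one hφ h]
        exact hφ.le_one _
      · rw [bump_scaled_eq_zero hφ h]
        exact hφ.nonneg _
  · refine (isAdapted_dyadicCutoff hφ).locallyFinite fun D => ?_
    refine (Set.finite_Iic ⌈D⌉₊).subset fun j hj => ?_
    have h1 : (j : ℝ) ≤ 2 ^ j := by exact_mod_cast Nat.lt_two_pow_self.le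
    have h2 : (j : ℝ) ≤ ⌈D⌉₊ := (h1.trans hj).trans (Nat.le_ceil D)
    exact_mod_cast h2
  · obtain ⟨n, hn⟩ := pow_unbounded_of_one_lt ‖ξ‖ (one_lt_two : (1 : ℝ) < 2)
    have hsub : (Function.support fun j => dyadicCutoff φ j ξ) ⊆ Finset.range (n + 1) := by
      intro j hj
      cases j with
      | zero => simp
      | succ j =>
        have h2 := (dyadicCutoff_lower hφ hj).trans_lt hn
        have h3 := (pow_lt_pow_iff_right₀ (one_lt_two : (1 : ℝ) < 2)).1 h2
        simpa using h3
    rw [finsum_eq_sum_of_support_subset _ hsub, dyadicCutoff_sum, bump_scaled_eq_one hφ hn]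

/-! ### The embeddings -/

theorem embeds_of_le {N₁ N₂ : 𝓢'(SpaceTime d, ℂ) → ℝ≥0∞} {A : ℝ}
    (h : ∀ u, N₁ u < ⊤ → N₂ u ≤ ENNReal.ofReal A * N₁ u) : Embeds N₁ N₂ :=
  ⟨fun u hu => (h u hu).trans_lt (ENNReal.mul_lt_top ENNReal.ofReal_lt_top hu), A.toNNReal, h⟩

theorem xNorm_eq (φ : Space d → ℝ) (C s α : ℝ) (u : 𝓢'(SpaceTime d, ℂ)) :
    xNorm φ C s α u = ∑' k, ENNReal.ofReal (scale α k ^ s) *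
      u2Norm (spatialMultiplier (alphaCutoff φ C α k) u) := by
  simp only [scale_rpow]
  rfl

theorem yNorm_eq (φ : Space d → ℝ) (C s α : ℝ) (u : 𝓢'(SpaceTime d, ℂ)) :
    yNorm φ C s α u = ⨆ k, ENNReal.ofReal (scale α k ^ s) *
      v2Norm (spatialMultiplier (alphaCutoff φ C α k) u) := by
  simp only [scale_rpow]
  rfl

theorem two_rpow_mul (j : ℕ) (s : ℝ) : (2 : ℝ) ^ ((j : ℝ) * s) = ((2 : ℝ) ^ j) ^ s := by
  rw [Real.rpow_mul (by norm_num), Real.rpow_natCast]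

theorem xOneNorm_eq (φ : Space d → ℝ) (s : ℝ) (u : 𝓢'(SpaceTime d, ℂ)) :
    xOneNorm φ s u = ∑' j : ℕ, ENNReal.ofReal (((2 : ℝ) ^ j) ^ s) *
      u2Norm (spatialMultiplier (dyadicCutoff φ j) u) := by
  simp only [← two_rpow_mul]
  rfl

theorem yOneNorm_eq (φ : Space d → ℝ) (s : ℝ) (u : 𝓢'(SpaceTime d, ℂ)) :
    yOneNorm φ s u = ⨆ j : ℕ, ENNReal.ofReal (((2 : ℝ) ^ j) ^ s) *
      v2Norm (spatialMultiplier (dyadicCutoff φ j) u) := by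
  simp only [← two_rpow_mul]
  rfl

/-- Embedding of the space built on a partition of unity adapted to the exponent `γ`
into the space `X^{s₂,α}`. -/
theorem embeds_xNorm {φ : Space d → ℝ} (hφ : IsRadialBump φ) {α C s₁ s₂ : ℝ} (h0 : 0 ≤ α)
    (h1 : α < 1) (hC : IsAdmissible φ C α) {ι : Type*} {a : ι → Space d → ℝ} {x : ι → Space d}
    {R : ι → ℝ} {γ c : ℝ} (hp : IsPartition a) (ha : IsAdapted a x R γ c)
    (hs : s₂ + d * (max α γ - α) / 2 ≤ s₁) :
    Embeds (fun u => ∑' i, ENNReal.ofReal (R i ^ s₁) * u2Norm (spatialMultiplier (a i) u))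
      (xNorm φ C s₂ α) := by
  obtain ⟨c', hb⟩ := isAdapted_alphaCutoff hφ hC.1 h0 h1
  obtain ⟨A, hA, h⟩ := exists_weight_le_left ha h0 h1 hb hs
  refine embeds_of_le (A := A) fun u _ => ?_
  rw [xNorm_eq]
  exact tsum_u2Norm_le hp (isPartition_alphaCutoff hφ hC h0 h1) hA h u

/-- Embedding of the space `Y^{s₁,α}` into the space built on a partition of unity adapted to the
exponent `γ`. -/
theorem yNorm_embeds {φ : Space d → ℝ} (hφ : IsRadialBump φ) {α C s₁ s₂ : ℝ} (h0 : 0 ≤ α)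
    (h1 : α < 1) (hC : IsAdmissible φ C α) {κ : Type*} {b : κ → Space d → ℝ} {x : κ → Space d}
    {R : κ → ℝ} {γ c : ℝ} (hp : IsPartition b) (hb : IsAdapted b x R γ c)
    (hs : s₂ + d * (max α γ - α) / 2 ≤ s₁) :
    Embeds (yNorm φ C s₁ α)
      (fun u => ⨆ k, ENNReal.ofReal (R k ^ s₂) * v2Norm (spatialMultiplier (b k) u)) := by
  obtain ⟨c', ha⟩ := isAdapted_alphaCutoff hφ hC.1 h0 h1
  obtain ⟨A, hA, h⟩ := exists_weight_le_right hb h0 h1 ha hs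
  obtain ⟨M, hM⟩ := ha.exists_overlap h0 h1
  refine embeds_of_le (A := √M * A) fun u hu => ?_
  rw [yNorm_eq] at hu ⊢
  exact iSup_v2Norm_le (isPartition_alphaCutoff hφ hC h0 h1) hp hM hA h u hu

theorem mul_max_sub (D α γ : ℝ) (hD : 0 ≤ D) :
    D * (max α γ - α) / 2 = max 0 (D * (γ - α) / 2) := by
  rcases le_total α γ with h | h
  · rw [max_eq_right h, max_eq_right]
    have := mul_nonneg hD (sub_nonneg.2 h)
    linarith
  · rw [max_eq_left h, max_eq_left]
    · ring
    · have := mul_nonneg hD (sub_nonneg.2 h)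
      linarith

end AlphaMod

end

theorem theorem2p1 (d : ℕ) (hd : 1 ≤ d) (φ : AlphaMod.Space d → ℝ)
    (hφ : AlphaMod.IsRadialBump φ) :
    -- (i)
    (∀ α₁ α₂ C₁ C₂ s₁ s₂ : ℝ, 0 ≤ α₁ → α₁ < 1 → 0 ≤ α₂ → α₂ < 1 →
      AlphaMod.IsAdmissible φ C₁ α₁ → AlphaMod.IsAdmissible φ C₂ α₂ →
      s₁ ≥ s₂ + max 0 ((d : ℝ) * (α₁ - α₂) / 2) →
      AlphaMod.Embeds (AlphaMod.xNorm φ C₁ s₁ α₁) (AlphaMod.xNorm φ C₂ s₂ α₂)) ∧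
    -- (ii)
    (∀ α C s₁ s₂ : ℝ, 0 ≤ α → α < 1 → AlphaMod.IsAdmissible φ C α →
      s₁ ≥ s₂ + (d : ℝ) * (1 - α) / 2 →
      AlphaMod.Embeds (AlphaMod.xOneNorm φ s₁) (AlphaMod.xNorm φ C s₂ α)) ∧
    -- (iii)
    (∀ α₁ α₂ C₁ C₂ s₁ s₂ : ℝ, 0 ≤ α₁ → α₁ < 1 → 0 ≤ α₂ → α₂ < 1 →
      AlphaMod.IsAdmissible φ C₁ α₁ → AlphaMod.IsAdmissible φ C₂ α₂ →
      s₁ ≥ s₂ + max 0 ((d : ℝ) * (α₂ - α₁) / 2) →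
      AlphaMod.Embeds (AlphaMod.yNorm φ C₁ s₁ α₁) (AlphaMod.yNorm φ C₂ s₂ α₂)) ∧
    -- (iv)
    (∀ α C s₁ s₂ : ℝ, 0 ≤ α → α < 1 → AlphaMod.IsAdmissible φ C α →
      s₁ ≥ s₂ + (d : ℝ) * (1 - α) / 2 →
      AlphaMod.Embeds (AlphaMod.yNorm φ C s₁ α) (AlphaMod.yOneNorm φ s₂)) := by
  have hd0 : (0 : ℝ) ≤ d := Nat.cast_nonneg d
  refine ⟨?_, ?_, ?_, ?_⟩
  · intro α₁ α₂ C₁ C₂ s₁ s₂ h1 h1' h2 h2' hC₁ hC₂ hs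
    obtain ⟨c, ha⟩ := AlphaMod.isAdapted_alphaCutoff hφ hC₁.1 h1 h1'
    have h := AlphaMod.embeds_xNorm hφ h2 h2' hC₂ (s₁ := s₁) (s₂ := s₂)
      (AlphaMod.isPartition_alphaCutoff hφ hC₁ h1 h1') ha
      (by rw [AlphaMod.mul_max_sub _ _ _ hd0]; exact hs)
    rwa [funext (AlphaMod.xNorm_eq φ C₁ s₁ α₁)]
  · intro α C s₁ s₂ h1 h1' hC hs
    have h := AlphaMod.embeds_xNorm hφ h1 h1' hC (s₁ := s₁) (s₂ := s₂)
      (AlphaMod.isPartition_dyadicCutoff hφ) (AlphaMod.isAdapted_dyadicCutoff hφ)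
      (by rw [max_eq_right h1'.le]; exact hs)
    rwa [funext (AlphaMod.xOneNorm_eq φ s₁)]
  · intro α₁ α₂ C₁ C₂ s₁ s₂ h1 h1' h2 h2' hC₁ hC₂ hs
    obtain ⟨c, hb⟩ := AlphaMod.isAdapted_alphaCutoff hφ hC₂.1 h2 h2'
    have h := AlphaMod.yNorm_embeds hφ h1 h1' hC₁ (s₁ := s₁) (s₂ := s₂)
      (AlphaMod.isPartition_alphaCutoff hφ hC₂ h2 h2') hb
      (by rw [AlphaMod.mul_max_sub _ _ _ hd0]; exact hs)
    rwa [funext (AlphaMod.yNorm_eq φ C₂ s₂ α₂)]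
  · intro α C s₁ s₂ h1 h1' hC hs
    have h := AlphaMod.yNorm_embeds hφ h1 h1' hC (s₁ := s₁) (s₂ := s₂)
      (AlphaMod.isPartition_dyadicCutoff hφ) (AlphaMod.isAdapted_dyadicCutoff hφ)
      (by rw [max_eq_right h1'.le]; exact hs)
    rwa [funext (AlphaMod.yOneNorm_eq φ s₂)]
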